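/- Let $G$ be a (real, finite-dimensional) Lie group with Lie algebra $\mathfrak g$ of left-invariant vector fields, equipped with a left-invariant almost Hermitian structure: a left-invariant Riemannian metric $g$ and a left-invariant almost complex structure $J$ with $g(JX,JY)=g(X,Y)$. Put $\omega(X,Y)=g(JX,Y)$ and $$N(X,Y)=J[JX,Y]+J[X,JY]+[X,Y]-[JX,JY],$$ and let $(d\omega)^+$ be the part of type $(2,1)+(1,2)$ of $d\omega$. Fix a standard frame, i.e. an orthonormal frame $e_1,\dots,e_{2n}$ of left-invariant vector fields with $Je_i=e_{n+i}$ for $1\le i\le n$, and let $[e_a,e_b]=\sum_c C^c_{ab}e_c$. For $\alpha\in\wedge^{(1,1)}\mathfrak g^*\otimes\mathfrak g$ (a left-invariant real $2$-form on $G$ with values in $TG$ such that $\alpha(JX,JY)=\alpha(X,Y)$) let $\alpha^c_{ab}=g(\alpha(e_a,e_b),e_c)$ and $\alpha^+(X,Y,Z)=g(\alpha(X,Y),Z)+g(\alpha(Y,Z),X)+g(\alpha(Z,X),Y)$, and let $\nabla^\alpha$ be the left-invariant Hermitian connection ($\nabla g=0$, $\nabla J=0$) whose torsion $T^\alpha$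 satisfies $$g(T^\alpha(X,Y),Z)=-\tfrac14 g(N(X,Y),Z)-\tfrac12(d\omega)^+(JX,JY,JZ)+\tfrac12(d\omega)^+(X,Y,JZ)+\tfrac12\alpha^+(X,Y,Z)-\tfrac12\alpha^+(JX,JY,Z)+g(\alpha(X,Y),Z).$$ Such a connection exists (and, as a metric connection, is determined by its torsion); its torsion is given, for all $1\le i,j,k\le n$, by $$g(T^\alpha(e_i,e_j),e_k)=-\frac{1}{2}C^k_{ij}-\frac{1}{4}C^j_{ik}+\frac{1}{4}C^i_{jk}+\frac{1}{2}C^k_{n+i,n+j}+\frac{1}{4}C^i_{n+j,n+k}+\frac{1}{4}C^j_{n+k,n+i}+\frac{1}{4}C^{n+i}_{j,n+k} +\frac{1}{4}C^{n+j}_{n+k,i}+\frac{1}{4}C^{n+i}_{k,n+j}-\frac{1}{4}C^{n+j}_{k,n+i}+\alpha^k_{ij}+\frac{1}{2}\alpha^i_{jk}+\frac{1}{2}\alpha^j_{ki}-\frac{1}{2}\alpha^{n+i}_{n+j,k}-\frac{1}{2}\alpha^{n+j}_{k,n+i}$$ $$g(T^\alpha(e_i,e_j),e_{n+k})=-\frac{1}{2}C^{n+k}_{ij}+\frac{1}{2}C^{n+k}_{n+i,n+j}-\frac{1}{4}C^j_{k,n+i}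 -\frac{1}{4}C^i_{n+j,k}-\frac{1}{4}C^j_{i,n+k} + \frac{1}{4}C^{n+i}_{n+k,n+j} + \frac{1}{4}C^i_{j,n+k} -\frac{1}{4}C^{n+j}_{n+k,n+i} -\frac{1}{4}C^{n+j}_{ki} -\frac{1}{4}C^{n+i}_{jk} +\alpha^{n+k}_{ij} + \frac{1}{2}\alpha^i_{j,n+k} + \frac{1}{2}\alpha^j_{n+k,i} - \frac{1}{2}\alpha^{n+i}_{n+j,n+k} - \frac{1}{2}\alpha^{n+j}_{n+k,n+i}$$ $$g(T^\alpha(e_i,e_{n+j}),e_k)=-\frac{1}{2}C^k_{n+i,j} - \frac{1}{2}C^k_{i,n+j} - \frac{1}{4}C^{n+j}_{n+i,n+k} +\frac{1}{4}C^i_{n+k,j} + \frac{1}{4}C^{n+i}_{n+j,n+k} - \frac{1}{4}C^j_{n+k,i} - \frac{1}{4}C^i_{k,n+j} -\frac{1}{4}C^j_{n+i,k} - \frac{1}{4}C^{n+j}_{ik} -\frac{1}{4}C^{n+i}_{kj} + \alpha^k_{i,n+j} +\frac{1}{2}\alpha^i_{n+j,k} + \frac{1}{2}\alpha^{n+j}_{ki}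 + \frac{1}{2}\alpha^{n+i}_{jk} + \frac{1}{2}\alpha^j_{k,n+i}$$ $$g(T^\alpha(e_i,e_{n+j}),e_{n+k})=-\frac{1}{2}C^{n+k}_{n+i,j} - \frac{1}{2}C^{n+k}_{i,n+j} + \frac{1}{4}C^i_{jk} -\frac{1}{4}C^{n+j}_{k,n+i} + \frac{1}{4}C^i_{n+j,n+k} + \frac{1}{4}C^j_{n+k,n+i} +\frac{1}{4}C^j_{ki} -\frac{1}{4}C^{n+i}_{n+j,k} -\frac{1}{4}C^{n+j}_{i,n+k} -\frac{1}{4}C^{n+i}_{n+k,j} +\alpha^{n+k}_{i,n+j} +\frac{1}{2}\alpha^i_{n+j,n+k} + \frac{1}{2}\alpha^{n+j}_{n+k,i} +\frac{1}{2}\alpha^{n+i}_{j,n+k} +\frac{1}{2}\alpha^j_{n+k,n+i}$$ $$g(T^\alpha(e_{n+i},e_{n+j}),e_k)=-\frac{1}{2} C_{n+i, n+j}^k + \frac{1}{2} C_{ij}^k -\frac{1}{4}C_{n+j, n+k}^i - \frac{1}{4}C_{n+k, n+i}^j -\frac{1}{4}C_{j, n+k}^{n+i} -\frac{1}{4}C_{n+k,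 i}^{n+j} - \frac{1}{4} C_{k, n+j}^{n+i} +\frac{1}{4} C_{ik}^{j}+\frac{1}{4}C_{kj}^i + \frac{1}{4}C_{k, n+i}^{n+j} + \alpha_{n+i, n+j}^k+\frac{1}{2}\alpha^j_{n+i,n+k}+\frac{1}{2}\alpha^{n+i}_{n+k,j}+\frac{1}{2}\alpha^{n+j}_{i,n+k}+\frac{1}{2}\alpha^i_{n+k,n+j}$$ $$g(T^\alpha(e_{n+i},e_{n+j}),e_{n+k})=-\frac{1}{2}C_{n+i, n+j}^{n+k}+\frac{1}{2}C_{ij}^{n+k} +\frac{1}{4}C_{n+j, k}^i +\frac{1}{4}C_{k,n+i}^j +\frac{1}{4}C_{jk}^{n+i} +\frac{1}{4} C_{ki}^{n+j} +\frac{1}{4}C_{n+j,n+k}^{n+i} -\frac{1}{4}C_{n+k, i}^j-\frac{1}{4}C_{j, n+k}^i + \frac{1}{4}C_{n+k, n+i}^{n+j} + \alpha_{n+i, n+j}^{n+k} + \frac{1}{2}\alpha_{n+j, n+k}^{n+i} +\frac{1}{2}\alpha_{n+k, n+i}^{n+j} - \frac{1}{2}\alpha_{j, n+k}^i -\frac{1}{2}\alpha_{n+k,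 i}^j$$ Moreover, for each $t\in\mathbb R$ there is exactly one $TG$-valued bilinear tensor field $\alpha^t$ with $$g(\alpha^t(X,Y),Z)=\tfrac t4(d\omega)^+(JX,JY,JZ)+\tfrac t4(d\omega)^+(X,Y,JZ);$$ it belongs to $\wedge^{(1,1)}\mathfrak g^*\otimes\mathfrak g$. The Gauduchon connection with parameter $t$ is $\nabla^{\alpha^t}$; its torsion $T^t=T^{\alpha^t}$ is thus given by the formulas above with $\alpha=\alpha^t$, and, explicitly, for all $1\le i,j,k\le n$, $$g(T^t(e_i,e_j),e_k)=\frac{t}{4}C^{n+k}_{n+i,j}+\frac{t}{4}C^{n+k}_{i,n+j}-\frac{1}{2}C^k_{ij}+\frac{-t+1}{2}C^k_{n+i,n+j}+\frac{1}{4}C^{n+i}_{j,n+k}+\frac{1}{4}C^{n+j}_{n+k,i} +\frac{-2t+1}{4}C^i_{n+j,n+k}+\frac{-2t+1}{4}C^j_{n+k,n+i}+\frac{-t+1}{4}C^i_{jk}+\frac{t-1}{4}C^{n+j}_{k,n+i}+\frac{t-1}{4}C^j_{ik}+\frac{-t+1}{4}C^{n+i}_{k,n+j}$$ $$g(T^t(e_i,e_j),e_{n+k})=\frac{-2t+1}{4}C^j_{n+i,k}+\frac{2t-1}{4}C^i_{n+j,k}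 + \frac{-t+1}{2}C^{n+k}_{n+i,n+j}+\frac{-t+1}{4}C^{n+j}_{n+i,n+k}+\frac{t-1}{4}C^{n+i}_{n+j,n+k} -\frac{t}{4}C^k_{i,n+j} +\frac{t-1}{4}C^j_{i,n+k} + \frac{-t+1}{4}C^i_{j,n+k} -\frac{t}{4}C^k_{n+i,j}-\frac{1}{2}C^{n+k}_{ij}+\frac{1}{4}C^{n+j}_{ik}-\frac{1}{4}C^{n+i}_{jk}$$ $$g(T^t(e_i,e_{n+j}),e_k)=\frac{-t+1}{4}C^i_{n+j,k} +\frac{t}{4}C^{n+k}_{n+i,n+j}+\frac{2t-1}{4}C^{n+j}_{n+i,n+k}-\frac{t}{4}C^{n+k}_{ij}+\frac{t-1}{4}C^{n+j}_{ik}+\frac{-t+1}{4}C^{n+i}_{jk} +\frac{2t-1}{4}C^i_{j,n+k}+\frac{t-1}{2}C^k_{n+i,j}+\frac{t-1}{4}C^j_{n+i,k}+\frac{1}{4}C^{n+i}_{n+j,n+k}-\frac{1}{2}C^k_{i,n+j}+\frac{1}{4}C^j_{i,n+k}$$ $$g(T^t(e_i,e_{n+j}),e_{n+k})=-\frac{t}{4}C^k_{n+i,n+j}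 + \frac{t-1}{4}C^j_{n+i,n+k} + \frac{-t+1}{4}C^i_{n+j,n+k} +\frac{t}{4}C^k_{ij} +\frac{-2t+1}{4}C^i_{jk} + \frac{t-1}{4}C^{n+j}_{i,n+k}+\frac{-t+1}{4}C^{n+i}_{j,n+k} +\frac{t-1}{2}C^{n+k}_{n+i,j}+\frac{-2t+1}{4}C^{n+j}_{n+i,k}-\frac{1}{2}C^{n+k}_{i,n+j}-\frac{1}{4}C^j_{ik}-\frac{1}{4}C^{n+i}_{n+j,k}$$ $$g(T^t(e_{n+i},e_{n+j}),e_k)=\frac{-t+1}{4}C^{n+i}_{n+j,k} + \frac{-t+1}{2}C^k_{ij} + \frac{-t+1}{4}C^j_{ik} +\frac{t-1}{4}C^i_{jk} -\frac{t}{4}C^{n+k}_{i,n+j} + \frac{-2t+1}{4}C^{n+j}_{i,n+k} +\frac{2t-1}{4}C^{n+i}_{j,n+k}-\frac{t}{4}C^{n+k}_{n+i,j} +\frac{t-1}{4}C^{n+j}_{n+i,k} -\frac{1}{2}C^k_{n+i,n+j}+\frac{1}{4}C^j_{n+i,n+k}-\frac{1}{4}C^i_{n+j,n+k}$$ $$g(T^t(e_{n+i},e_{n+j}),e_{n+k})=\frac{t-1}{4}C^{n+j}_{n+i,n+k}+\frac{-t+1}{4}C^{n+i}_{n+j,n+k}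 +\frac{-t+1}{2}C^{n+k}_{ij}+\frac{2t-1}{4}C^{n+j}_{ik}+\frac{t}{4}C^k_{i,n+j} +\frac{-t+1}{4}C^j_{i,n+k}+\frac{-2t+1}{4}C^{n+i}_{jk}+\frac{t-1}{4}C^i_{j,n+k}+\frac{t}{4}C^k_{n+i,j}+\frac{1}{4}C^i_{n+j,k}-\frac{1}{2}C^{n+k}_{n+i,n+j}-\frac{1}{4}C^j_{n+i,k}$$ -/

import Mathlib

open Bundle VectorField
open scoped Manifold ContDiff
open Sum (inl inr)

noncomputable section

/-! ### Complex-trilinear extensions and the (2,1)+(1,2)-part of a 3-form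

A complex vector `u + i v` over a real vector space `V` is represented by the pair `(u, v)`. -/

namespace AlmostHermitian

section TypeDecomposition

variable {V : Type*} [AddCommGroup V] [Module ℝ V]

/-- The (1,0)-component `X⁺ = (X - i J X) / 2` of `X`. -/
def plusVec (J : V → V) (X : V) : V × V := ((1 / 2 : ℝ) • X, (-(1 / 2) : ℝ) • J X)

/-- The (0,1)-component `X⁻ = (X + i J X) / 2` of `X`. -/
def minusVec (J : V → V) (X : V) : V × V := ((1 / 2 : ℝ) • X, (1 / 2 : ℝ) • J X)

/-- The complex-trilinear extension of a real trilinear `η`, evaluated on complex vectors: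
the expansion of `η (X.1 + i X.2, Y.1 + i Y.2, Z.1 + i Z.2)`. -/
def complexExt (η : V → V → V → ℝ) (X Y Z : V × V) : ℂ :=
  ⟨η X.1 Y.1 Z.1 - η X.1 Y.2 Z.2 - η X.2 Y.1 Z.2 - η X.2 Y.2 Z.1,
    η X.2 Y.1 Z.1 + η X.1 Y.2 Z.1 + η X.1 Y.1 Z.2 - η X.2 Y.2 Z.2⟩

/-- The part `η⁺` of type (2,1)+(1,2) of a real 3-form `η`, on real arguments. The sum of the six
terms is real (they come in conjugate pairs), so that taking the real part loses nothing. -/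
def plusPart (J : V → V) (η : V → V → V → ℝ) (X Y Z : V) : ℝ :=
  (complexExt η (plusVec J X) (plusVec J Y) (minusVec J Z)
    + complexExt η (plusVec J X) (minusVec J Y) (plusVec J Z)
    + complexExt η (minusVec J X) (plusVec J Y) (plusVec J Z)
    + complexExt η (minusVec J X) (minusVec J Y) (plusVec J Z)
    + complexExt η (minusVec J X) (plusVec J Y) (minusVec J Z)
    + complexExt η (plusVec J X) (minusVec J Y) (minusVec J Z)).re

end TypeDecomposition

section Manifold

variable {E : Type*} [NormedAddCommGroup E] [NormedSpace ℝ E]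
  {H : Type*} [TopologicalSpace H] (I : ModelWithCorners ℝ E H)
  {M : Type*} [TopologicalSpace M] [ChartedSpace H M]

/-- The vector field `J X`. -/
def applyField {I : ModelWithCorners ℝ E H}
    (J : ∀ x : M, TangentSpace I x →L[ℝ] TangentSpace I x)
    (X : ∀ x : M, TangentSpace I x) : ∀ x : M, TangentSpace I x := fun x => J x (X x)

/-- The Nijenhuis tensor `N(X, Y) = J[JX, Y] + J[X, JY] + [X, Y] - [JX, JY]`. -/
def nijenhuis (J : ∀ x : M, TangentSpace I x →L[ℝ] TangentSpace I x)
    (X Y : ∀ x : M, TangentSpace I x) (x : M) : TangentSpace I x :=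
  J x (mlieBracket I (applyField J X) Y x) + J x (mlieBracket I X (applyField J Y) x)
    + mlieBracket I X Y x - mlieBracket I (applyField J X) (applyField J Y) x

variable [RiemannianBundle (fun x : M => TangentSpace I x)]

/-- The fundamental form `ω(u, v) = g(J u, v)`. -/
def fundForm (J : ∀ x : M, TangentSpace I x →L[ℝ] TangentSpace I x) (x : M)
    (u v : TangentSpace I x) : ℝ := inner ℝ (J x u) v

/-- The exterior derivative `dω` at `x`, by the invariant formula
`dω(X, Y, Z) = X ω(Y, Z) - Y ω(X, Z) + Z ω(X, Y) - ω([X, Y], Z) + ω([X, Z], Y) - ω([Y, Z], X)`. -/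
def dFundForm (J : ∀ x : M, TangentSpace I x →L[ℝ] TangentSpace I x) (x : M)
    (X Y Z : ∀ x : M, TangentSpace I x) : ℝ :=
  mvfderiv I (fun y => fundForm I J y (Y y) (Z y)) x (X x)
    - mvfderiv I (fun y => fundForm I J y (X y) (Z y)) x (Y x)
    + mvfderiv I (fun y => fundForm I J y (X y) (Y y)) x (Z x)
    - fundForm I J x (mlieBracket I X Y x) (Z x)
    + fundForm I J x (mlieBracket I X Z x) (Y x)
    - fundForm I J x (mlieBracket I Y Z x) (X x)

/-- `(dω)⁺(X, Y, Z)` at `x`. -/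
def dFundFormPlus (J : ∀ x : M, TangentSpace I x →L[ℝ] TangentSpace I x) (x : M)
    (X Y Z : ∀ x : M, TangentSpace I x) : ℝ :=
  plusPart (applyField J) (dFundForm I J x) X Y Z

/-- `α⁺(u, v, w) = g(α(u, v), w) + g(α(v, w), u) + g(α(w, u), v)`. -/
def cyclicSum (α : ∀ x : M, TangentSpace I x →L[ℝ] TangentSpace I x →L[ℝ] TangentSpace I x)
    (x : M) (u v w : TangentSpace I x) : ℝ :=
  inner ℝ (α x u v) w + inner ℝ (α x v w) u + inner ℝ (α x w u) v

/-- The value at `x` of `g(T^α(X, Y), Z)`, where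
`g(T^α(X, Y), Z) = -1/4 g(N(X, Y), Z) - 1/2 (dω)⁺(JX, JY, JZ) + 1/2 (dω)⁺(X, Y, JZ)
  + 1/2 α⁺(X, Y, Z) - 1/2 α⁺(JX, JY, Z) + g(α(X, Y), Z)`. -/
def torsionForm (J : ∀ x : M, TangentSpace I x →L[ℝ] TangentSpace I x)
    (α : ∀ x : M, TangentSpace I x →L[ℝ] TangentSpace I x →L[ℝ] TangentSpace I x)
    (x : M) (X Y Z : ∀ x : M, TangentSpace I x) : ℝ :=
  -(1 / 4) * inner ℝ (nijenhuis I J X Y x) (Z x)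
    - 1 / 2 * dFundFormPlus I J x (applyField J X) (applyField J Y) (applyField J Z)
    + 1 / 2 * dFundFormPlus I J x X Y (applyField J Z)
    + 1 / 2 * cyclicSum I α x (X x) (Y x) (Z x)
    - 1 / 2 * cyclicSum I α x (J x (X x)) (J x (Y x)) (Z x)
    + inner ℝ (α x (X x) (Y x)) (Z x)

variable [IsManifold I 1 M]

/-- `(g, J)` is an almost Hermitian structure, with `g` the Riemannian metric of the tangent
bundle: `J` is a smooth field of endomorphisms with `J² = -1` and `g(JX, JY) = g(X, Y)`. -/
structure IsAlmostHermitian (J : ∀ x : M, TangentSpace I x →L[ℝ] TangentSpace I x) : Prop where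
  smooth : ContMDiff I (I.prod 𝓘(ℝ, E →L[ℝ] E)) ∞
    (fun x => TotalSpace.mk' (E →L[ℝ] E) (E := fun x : M => TangentSpace I x →L[ℝ] TangentSpace I x)
      x (J x))
  sq : ∀ (x : M) (v : TangentSpace I x), J x (J x v) = -v
  inner_map : ∀ (x : M) (v w : TangentSpace I x),
    inner ℝ (J x v) (J x w) = (inner ℝ v w : ℝ)

/-- `α` is the form `α^t` of the Gauduchon connection with parameter `t`:
`g(α^t(X, Y), Z) = t/4 (dω)⁺(JX, JY, JZ) + t/4 (dω)⁺(X, Y, JZ)`. -/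
def IsGauduchonForm (J : ∀ x : M, TangentSpace I x →L[ℝ] TangentSpace I x) (t : ℝ)
    (α : ∀ x : M, TangentSpace I x →L[ℝ] TangentSpace I x →L[ℝ] TangentSpace I x) : Prop :=
  ∀ (x : M) (X Y Z : ∀ x : M, TangentSpace I x),
    MDiffAt (T% X) x → MDiffAt (T% Y) x → MDiffAt (T% Z) x →
    inner ℝ (α x (X x) (Y x)) (Z x)
      = t / 4 * dFundFormPlus I J x (applyField J X) (applyField J Y) (applyField J Z)
        + t / 4 * dFundFormPlus I J x X Y (applyField J Z)

variable [FiniteDimensional ℝ E] [CompleteSpace E] [IsManifold I 2 M]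
  [IsContMDiffRiemannianBundle I 1 E (fun x : M => TangentSpace I x)]

/-- A connection is Hermitian if `∇g = 0` and `∇J = 0`. -/
structure IsHermitianConnection (J : ∀ x : M, TangentSpace I x →L[ℝ] TangentSpace I x)
    (cov : CovariantDerivative I E (fun x : M => TangentSpace I x)) : Prop where
  metric : CovariantDerivative.IsMetricCompatible (V := fun x : M => TangentSpace I x) cov
  complex : ∀ (x : M) (Y : ∀ x : M, TangentSpace I x), MDiffAt (T% Y) x →
    ∀ v : TangentSpace I x, cov (applyField J Y) x v = J x (cov Y x v)

/-- The torsion of `∇` is the one associated to `α`: `g(T(X, Y), Z) = g(T^α(X, Y), Z)`. Both sides are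
tensorial, so that testing on fields differentiable at the point, or on smooth fields, is the
same. -/
def HasTorsionOf (J : ∀ x : M, TangentSpace I x →L[ℝ] TangentSpace I x)
    (α : ∀ x : M, TangentSpace I x →L[ℝ] TangentSpace I x →L[ℝ] TangentSpace I x)
    (cov : CovariantDerivative I E (fun x : M => TangentSpace I x)) : Prop :=
  ∀ (x : M) (X Y Z : ∀ x : M, TangentSpace I x),
    MDiffAt (T% X) x → MDiffAt (T% Y) x → MDiffAt (T% Z) x →
    inner ℝ (cov.torsion x (X x) (Y x)) (Z x) = torsionForm I J α x X Y Z

end Manifold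

section LeftInvariant

variable {E : Type*} [NormedAddCommGroup E] [NormedSpace ℝ E]
  {H : Type*} [TopologicalSpace H] (I : ModelWithCorners ℝ E H)
  {G : Type*} [TopologicalSpace G] [ChartedSpace H G] [Group G]

/-- A connection on `G` is left-invariant if `∇_X Y` is left-invariant for all left-invariant
`X, Y`. (Such a connection is automatically smooth: its components in a left-invariant frame are
constant.) -/
def IsLeftInvariantConnection [IsManifold I 1 G]
    (cov : CovariantDerivative I E (fun x : G => TangentSpace I x)) : Prop :=
  ∀ v w : GroupLieAlgebra I G, ∃ u : GroupLieAlgebra I G, ∀ x : G,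
    cov (mulInvariantVectorField w) x (mulInvariantVectorField v x) = mulInvariantVectorField u x

/-- `α` is a left-invariant real `TG`-valued 2-form of type (1,1), i.e. an element of
`Λ^(1,1) 𝔤* ⊗ 𝔤` seen as a tensor field on `G` (smooth, because left-invariant). -/
structure IsLeftInvariantForm11 (J : ∀ x : G, TangentSpace I x →L[ℝ] TangentSpace I x)
    (α : ∀ x : G, TangentSpace I x →L[ℝ] TangentSpace I x →L[ℝ] TangentSpace I x) : Prop where
  alternating : ∀ (x : G) (v : TangentSpace I x), α x v v = 0
  type11 : ∀ (x : G) (v w : TangentSpace I x), α x (J x v) (J x w) = α x v w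
  leftInvariant : ∀ (v w : GroupLieAlgebra I G) (x : G),
    α x (mulInvariantVectorField v x) (mulInvariantVectorField w x)
      = mulInvariantVectorField (α 1 v w : GroupLieAlgebra I G) x

variable [RiemannianBundle (fun x : G => TangentSpace I x)]

/-- The metric and `J` are left-invariant: for left-invariant fields `X, Y`, the function `g(X, Y)`
is constant and `J X` is left-invariant. -/
structure IsLeftInvariantStructure
    (J : ∀ x : G, TangentSpace I x →L[ℝ] TangentSpace I x) : Prop where
  metric : ∀ (v w : GroupLieAlgebra I G) (x y : G),
    inner ℝ (mulInvariantVectorField v x) (mulInvariantVectorField w x)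
      = (inner ℝ (mulInvariantVectorField v y) (mulInvariantVectorField w y) : ℝ)
  complex : ∀ (v : GroupLieAlgebra I G) (x : G),
    J x (mulInvariantVectorField v x) = mulInvariantVectorField (J 1 v : GroupLieAlgebra I G) x

/-- A standard frame `(e_1, …, e_n | e_{n+1}, …, e_{2n})`, where `e (inl i)` is `e_i` and
`e (inr i)` is `e_{n+i}`: an orthonormal frame of left-invariant vector fields with
`J e_i = e_{n+i}`. The left-invariant field `e_a` is recorded by its value at the identity. -/
structure IsStandardFrame (J : ∀ x : G, TangentSpace I x →L[ℝ] TangentSpace I x) {n : ℕ}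
    (e : Module.Basis (Fin n ⊕ Fin n) ℝ (GroupLieAlgebra I G)) : Prop where
  orthonormal : ∀ x : G, Orthonormal ℝ (fun a => mulInvariantVectorField (e a) x)
  map_J : ∀ (i : Fin n) (x : G),
    J x (mulInvariantVectorField (e (inl i)) x) = mulInvariantVectorField (e (inr i)) x

/-- The structure constant `C^c_{ab}`, written `structConst I e a b c`:
`[e_a, e_b] = ∑ c, C^c_{ab} e_c`. -/
def structConst {n : ℕ} (e : Module.Basis (Fin n ⊕ Fin n) ℝ (GroupLieAlgebra I G))
    (a b c : Fin n ⊕ Fin n) : ℝ := e.repr ⁅e a, e b⁆ c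

/-- The component `T^c_{ab} = g(T(e_a, e_b), e_c)` at `x`, written `component I e T x a b c`. -/
def component {n : ℕ} (e : Module.Basis (Fin n ⊕ Fin n) ℝ (GroupLieAlgebra I G))
    (T : ∀ x : G, TangentSpace I x →L[ℝ] TangentSpace I x →L[ℝ] TangentSpace I x) (x : G)
    (a b c : Fin n ⊕ Fin n) : ℝ :=
  inner ℝ (T x (mulInvariantVectorField (e a) x) (mulInvariantVectorField (e b) x))
    (mulInvariantVectorField (e c) x)

/-- The six families of torsion components, in terms of `C a b c = C^c_{ab}` and
`A a b c = α^c_{ab}`, where `T a b c = g(T(e_a, e_b), e_c)`. -/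
structure HermitianTorsionFormulas {n : ℕ}
    (C A T : Fin n ⊕ Fin n → Fin n ⊕ Fin n → Fin n ⊕ Fin n → ℝ) : Prop where
  e_e_e : ∀ i j k : Fin n, T (inl i) (inl j) (inl k) =
      -(1 / 2) * C (inl i) (inl j) (inl k) - 1 / 4 * C (inl i) (inl k) (inl j) + 1 / 4 * C (inl j) (inl k) (inl i)
      + 1 / 2 * C (inr i) (inr j) (inl k) + 1 / 4 * C (inr j) (inr k) (inl i) + 1 / 4 * C (inr k) (inr i) (inl j)
      + 1 / 4 * C (inl j) (inr k) (inr i) + 1 / 4 * C (inr k) (inl i) (inr j) + 1 / 4 * C (inl k) (inr j) (inr i)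
      - 1 / 4 * C (inl k) (inr i) (inr j) + A (inl i) (inl j) (inl k) + 1 / 2 * A (inl j) (inl k) (inl i)
      + 1 / 2 * A (inl k) (inl i) (inl j) - 1 / 2 * A (inr j) (inl k) (inr i) - 1 / 2 * A (inl k) (inr i) (inr j)
  e_e_f : ∀ i j k : Fin n, T (inl i) (inl j) (inr k) =
      -(1 / 2) * C (inl i) (inl j) (inr k) + 1 / 2 * C (inr i) (inr j) (inr k) - 1 / 4 * C (inl k) (inr i) (inl j)
      - 1 / 4 * C (inr j) (inl k) (inl i) - 1 / 4 * C (inl i) (inr k) (inl j) + 1 / 4 * C (inr k) (inr j) (inr i)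
      + 1 / 4 * C (inl j) (inr k) (inl i) - 1 / 4 * C (inr k) (inr i) (inr j) - 1 / 4 * C (inl k) (inl i) (inr j)
      - 1 / 4 * C (inl j) (inl k) (inr i) + A (inl i) (inl j) (inr k) + 1 / 2 * A (inl j) (inr k) (inl i)
      + 1 / 2 * A (inr k) (inl i) (inl j) - 1 / 2 * A (inr j) (inr k) (inr i) - 1 / 2 * A (inr k) (inr i) (inr j)
  e_f_e : ∀ i j k : Fin n, T (inl i) (inr j) (inl k) =
      -(1 / 2) * C (inr i) (inl j) (inl k) - 1 / 2 * C (inl i) (inr j) (inl k) - 1 / 4 * C (inr i) (inr k) (inr j)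
      + 1 / 4 * C (inr k) (inl j) (inl i) + 1 / 4 * C (inr j) (inr k) (inr i) - 1 / 4 * C (inr k) (inl i) (inl j)
      - 1 / 4 * C (inl k) (inr j) (inl i) - 1 / 4 * C (inr i) (inl k) (inl j) - 1 / 4 * C (inl i) (inl k) (inr j)
      - 1 / 4 * C (inl k) (inl j) (inr i) + A (inl i) (inr j) (inl k) + 1 / 2 * A (inr j) (inl k) (inl i)
      + 1 / 2 * A (inl k) (inl i) (inr j) + 1 / 2 * A (inl j) (inl k) (inr i) + 1 / 2 * A (inl k) (inr i) (inl j)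
  e_f_f : ∀ i j k : Fin n, T (inl i) (inr j) (inr k) =
      -(1 / 2) * C (inr i) (inl j) (inr k) - 1 / 2 * C (inl i) (inr j) (inr k) + 1 / 4 * C (inl j) (inl k) (inl i)
      - 1 / 4 * C (inl k) (inr i) (inr j) + 1 / 4 * C (inr j) (inr k) (inl i) + 1 / 4 * C (inr k) (inr i) (inl j)
      + 1 / 4 * C (inl k) (inl i) (inl j) - 1 / 4 * C (inr j) (inl k) (inr i) - 1 / 4 * C (inl i) (inr k) (inr j)
      - 1 / 4 * C (inr k) (inl j) (inr i) + A (inl i) (inr j) (inr k) + 1 / 2 * A (inr j) (inr k) (inl i)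
      + 1 / 2 * A (inr k) (inl i) (inr j) + 1 / 2 * A (inl j) (inr k) (inr i) + 1 / 2 * A (inr k) (inr i) (inl j)
  f_f_e : ∀ i j k : Fin n, T (inr i) (inr j) (inl k) =
      -(1 / 2) * C (inr i) (inr j) (inl k) + 1 / 2 * C (inl i) (inl j) (inl k) - 1 / 4 * C (inr j) (inr k) (inl i)
      - 1 / 4 * C (inr k) (inr i) (inl j) - 1 / 4 * C (inl j) (inr k) (inr i) - 1 / 4 * C (inr k) (inl i) (inr j)
      - 1 / 4 * C (inl k) (inr j) (inr i) + 1 / 4 * C (inl i) (inl k) (inl j) + 1 / 4 * C (inl k) (inl j) (inl i)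
      + 1 / 4 * C (inl k) (inr i) (inr j) + A (inr i) (inr j) (inl k) + 1 / 2 * A (inr i) (inr k) (inl j)
      + 1 / 2 * A (inr k) (inl j) (inr i) + 1 / 2 * A (inl i) (inr k) (inr j) + 1 / 2 * A (inr k) (inr j) (inl i)
  f_f_f : ∀ i j k : Fin n, T (inr i) (inr j) (inr k) =
      -(1 / 2) * C (inr i) (inr j) (inr k) + 1 / 2 * C (inl i) (inl j) (inr k) + 1 / 4 * C (inr j) (inl k) (inl i)
      + 1 / 4 * C (inl k) (inr i) (inl j) + 1 / 4 * C (inl j) (inl k) (inr i) + 1 / 4 * C (inl k) (inl i) (inr j)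
      + 1 / 4 * C (inr j) (inr k) (inr i) - 1 / 4 * C (inr k) (inl i) (inl j) - 1 / 4 * C (inl j) (inr k) (inl i)
      + 1 / 4 * C (inr k) (inr i) (inr j) + A (inr i) (inr j) (inr k) + 1 / 2 * A (inr j) (inr k) (inr i)
      + 1 / 2 * A (inr k) (inr i) (inr j) - 1 / 2 * A (inl j) (inr k) (inl i) - 1 / 2 * A (inr k) (inl i) (inl j)

/-- The six families of torsion components of the Gauduchon connection with parameter `t`, in terms
of `C a b c = C^c_{ab}`, where `T a b c = g(T(e_a, e_b), e_c)`. -/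
structure GauduchonTorsionFormulas {n : ℕ} (t : ℝ)
    (C T : Fin n ⊕ Fin n → Fin n ⊕ Fin n → Fin n ⊕ Fin n → ℝ) : Prop where
  e_e_e : ∀ i j k : Fin n, T (inl i) (inl j) (inl k) =
      t / 4 * C (inr i) (inl j) (inr k) + t / 4 * C (inl i) (inr j) (inr k) - 1 / 2 * C (inl i) (inl j) (inl k)
      + (-t + 1) / 2 * C (inr i) (inr j) (inl k) + 1 / 4 * C (inl j) (inr k) (inr i) + 1 / 4 * C (inr k) (inl i) (inr j)
      + (-2 * t + 1) / 4 * C (inr j) (inr k) (inl i) + (-2 * t + 1) / 4 * C (inr k) (inr i) (inl j) + (-t + 1) / 4 * C (inl j) (inl k) (inl i)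
      + (t - 1) / 4 * C (inl k) (inr i) (inr j) + (t - 1) / 4 * C (inl i) (inl k) (inl j) + (-t + 1) / 4 * C (inl k) (inr j) (inr i)
  e_e_f : ∀ i j k : Fin n, T (inl i) (inl j) (inr k) =
      (-2 * t + 1) / 4 * C (inr i) (inl k) (inl j) + (2 * t - 1) / 4 * C (inr j) (inl k) (inl i) + (-t + 1) / 2 * C (inr i) (inr j) (inr k)
      + (-t + 1) / 4 * C (inr i) (inr k) (inr j) + (t - 1) / 4 * C (inr j) (inr k) (inr i) - t / 4 * C (inl i) (inr j) (inl k)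
      + (t - 1) / 4 * C (inl i) (inr k) (inl j) + (-t + 1) / 4 * C (inl j) (inr k) (inl i) - t / 4 * C (inr i) (inl j) (inl k)
      - 1 / 2 * C (inl i) (inl j) (inr k) + 1 / 4 * C (inl i) (inl k) (inr j) - 1 / 4 * C (inl j) (inl k) (inr i)
  e_f_e : ∀ i j k : Fin n, T (inl i) (inr j) (inl k) =
      (-t + 1) / 4 * C (inr j) (inl k) (inl i) + t / 4 * C (inr i) (inr j) (inr k) + (2 * t - 1) / 4 * C (inr i) (inr k) (inr j)
      - t / 4 * C (inl i) (inl j) (inr k) + (t - 1) / 4 * C (inl i) (inl k) (inr j) + (-t + 1) / 4 * C (inl j) (inl k) (inr i)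
      + (2 * t - 1) / 4 * C (inl j) (inr k) (inl i) + (t - 1) / 2 * C (inr i) (inl j) (inl k) + (t - 1) / 4 * C (inr i) (inl k) (inl j)
      + 1 / 4 * C (inr j) (inr k) (inr i) - 1 / 2 * C (inl i) (inr j) (inl k) + 1 / 4 * C (inl i) (inr k) (inl j)
  e_f_f : ∀ i j k : Fin n, T (inl i) (inr j) (inr k) =
      -(t / 4) * C (inr i) (inr j) (inl k) + (t - 1) / 4 * C (inr i) (inr k) (inl j) + (-t + 1) / 4 * C (inr j) (inr k) (inl i)
      + t / 4 * C (inl i) (inl j) (inl k) + (-2 * t + 1) / 4 * C (inl j) (inl k) (inl i) + (t - 1) / 4 * C (inl i) (inr k) (inr j)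
      + (-t + 1) / 4 * C (inl j) (inr k) (inr i) + (t - 1) / 2 * C (inr i) (inl j) (inr k) + (-2 * t + 1) / 4 * C (inr i) (inl k) (inr j)
      - 1 / 2 * C (inl i) (inr j) (inr k) - 1 / 4 * C (inl i) (inl k) (inl j) - 1 / 4 * C (inr j) (inl k) (inr i)
  f_f_e : ∀ i j k : Fin n, T (inr i) (inr j) (inl k) =
      (-t + 1) / 4 * C (inr j) (inl k) (inr i) + (-t + 1) / 2 * C (inl i) (inl j) (inl k) + (-t + 1) / 4 * C (inl i) (inl k) (inl j)
      + (t - 1) / 4 * C (inl j) (inl k) (inl i) - t / 4 * C (inl i) (inr j) (inr k) + (-2 * t + 1) / 4 * C (inl i) (inr k) (inr j)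
      + (2 * t - 1) / 4 * C (inl j) (inr k) (inr i) - t / 4 * C (inr i) (inl j) (inr k) + (t - 1) / 4 * C (inr i) (inl k) (inr j)
      - 1 / 2 * C (inr i) (inr j) (inl k) + 1 / 4 * C (inr i) (inr k) (inl j) - 1 / 4 * C (inr j) (inr k) (inl i)
  f_f_f : ∀ i j k : Fin n, T (inr i) (inr j) (inr k) =
      (t - 1) / 4 * C (inr i) (inr k) (inr j) + (-t + 1) / 4 * C (inr j) (inr k) (inr i) + (-t + 1) / 2 * C (inl i) (inl j) (inr k)
      + (2 * t - 1) / 4 * C (inl i) (inl k) (inr j) + t / 4 * C (inl i) (inr j) (inl k) + (-t + 1) / 4 * C (inl i) (inr k) (inl j)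
      + (-2 * t + 1) / 4 * C (inl j) (inl k) (inr i) + (t - 1) / 4 * C (inl j) (inr k) (inl i) + t / 4 * C (inr i) (inl j) (inl k)
      + 1 / 4 * C (inr j) (inl k) (inl i) - 1 / 2 * C (inr i) (inr j) (inr k) - 1 / 4 * C (inr i) (inl k) (inl j)

end LeftInvariant

end AlmostHermitian

end

/-! Every quantity in the theorem is a tensor, and a tensor on `G` is determined at each point by
its values on the left-invariant frame. On that frame nothing is differentiated: `g` and `ω` are
constant on left-invariant fields, so the invariant formula for `dω` keeps only its bracket terms.
Since J sends e_a to ± e_(a.swap), the Nijenhuis tensor, `dω`, its (2,1)+(1,2) part and finally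
`T^α` have coefficients that are linear in the structure constants C and the coefficients A of `α`.
The torsion formulas are then identities between linear forms. They follow from antisymmetry of C in
its lower indices and, for general `α`, antisymmetry and type (1,1) of A; the Jacobi identity plays
no role.

Tensoriality is carried by `TrilinearAt` and its closure properties, the reduction to the frame by
`IsStandardFrame.trilinear_congr`, and the translation into coefficients by
`IsStandardFrame.torsionForm_frame`. Thus `IsStandardFrame.hasTorsionOf_iff` turns the torsion
condition into an equality of arrays of numbers.

For existence, take the flat connection making the frame parallel and add the tensor whose
coefficients Γ are given by the Koszul formula with torsion. Skew-symmetry of Γ in its last two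
indices gives `∇g = 0`, its antisymmetrization in the first two gives the torsion, and `∇J = 0` is
the linear identity `connectionCoeff_complex`.

The Gauduchon form is the tensor with the prescribed coefficients. Testing on the frame gives
uniqueness and tensoriality gives existence; substituting these coefficients into those of `T^α`
gives the last six formulas. -/

noncomputable section

set_option linter.unusedSectionVars false

namespace AlmostHermitian

/-! ### Tensoriality of the Nijenhuis tensor, `dω`, `(dω)⁺` and `T^α`. -/

section Tensoriality

variable {E : Type*} [NormedAddCommGroup E] [NormedSpace ℝ E]
  {H : Type*} [TopologicalSpace H] {I : ModelWithCorners ℝ E H}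
  {M : Type*} [TopologicalSpace M] [ChartedSpace H M]

variable {J : ∀ x : M, TangentSpace I x →L[ℝ] TangentSpace I x}

lemma applyField_smul (f : M → ℝ) (X : ∀ x : M, TangentSpace I x) :
    applyField J (f • X) = f • applyField J X := by
  funext y
  simp [applyField]

lemma applyField_add (X Y : ∀ x : M, TangentSpace I x) :
    applyField J (X + Y) = applyField J X + applyField J Y := by
  funext y
  simp [applyField]

section

variable [RiemannianBundle (fun x : M => TangentSpace I x)]

lemma fundForm_add_left (x : M) (u v w : TangentSpace I x) :
    fundForm I J x (u + v) w = fundForm I J x u w + fundForm I J x v w := by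
  simp [fundForm, inner_add_left]

lemma fundForm_neg_left (x : M) (u v : TangentSpace I x) :
    fundForm I J x (-u) v = -fundForm I J x u v := by
  simp [fundForm]

lemma fundForm_add_right (x : M) (u v w : TangentSpace I x) :
    fundForm I J x u (v + w) = fundForm I J x u v + fundForm I J x u w := by
  simp [fundForm, inner_add_right]

lemma fundForm_smul_left (x : M) (c : ℝ) (u v : TangentSpace I x) :
    fundForm I J x (c • u) v = c * fundForm I J x u v := by
  simp [fundForm, inner_smul_left]

lemma fundForm_smul_right (x : M) (c : ℝ) (u v : TangentSpace I x) :
    fundForm I J x u (c • v) = c * fundForm I J x u v := by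
  simp [fundForm, inner_smul_right]

end

variable [IsManifold I 1 M]

/-- An operation on triples of vector fields is tensorial at `x` if it is tensorial at `x` in each
argument, the other two being differentiable at `x`. -/
structure TrilinearAt (Φ : (∀ x : M, TangentSpace I x) → (∀ x : M, TangentSpace I x) →
    (∀ x : M, TangentSpace I x) → ℝ) (x : M) : Prop where
  first : ∀ Y Z, MDiffAt (T% Y) x → MDiffAt (T% Z) x → TensorialAt I E (fun X => Φ X Y Z) x
  second : ∀ X Z, MDiffAt (T% X) x → MDiffAt (T% Z) x → TensorialAt I E (fun Y => Φ X Y Z) x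
  third : ∀ X Y, MDiffAt (T% X) x → MDiffAt (T% Y) x → TensorialAt I E (fun Z => Φ X Y Z) x

variable {Φ Ψ : (∀ x : M, TangentSpace I x) → (∀ x : M, TangentSpace I x) →
    (∀ x : M, TangentSpace I x) → ℝ} {x : M}

lemma TrilinearAt.add (hΦ : TrilinearAt Φ x) (hΨ : TrilinearAt Ψ x) :
    TrilinearAt (fun X Y Z => Φ X Y Z + Ψ X Y Z) x where
  first Y Z hY hZ :=
    { smul := fun hf hX => by
        simp only [(hΦ.first Y Z hY hZ).smul hf hX, (hΨ.first Y Z hY hZ).smul hf hX, smul_add]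
      add := fun hX hX' => by
        simp only [(hΦ.first Y Z hY hZ).add hX hX', (hΨ.first Y Z hY hZ).add hX hX']
        ring }
  second X Z hX hZ :=
    { smul := fun hf hY => by
        simp only [(hΦ.second X Z hX hZ).smul hf hY, (hΨ.second X Z hX hZ).smul hf hY, smul_add]
      add := fun hY hY' => by
        simp only [(hΦ.second X Z hX hZ).add hY hY', (hΨ.second X Z hX hZ).add hY hY']
        ring }
  third X Y hX hY :=
    { smul := fun hf hZ => by
        simp only [(hΦ.third X Y hX hY).smul hf hZ, (hΨ.third X Y hX hY).smul hf hZ, smul_add]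
      add := fun hZ hZ' => by
        simp only [(hΦ.third X Y hX hY).add hZ hZ', (hΨ.third X Y hX hY).add hZ hZ']
        ring }

lemma TrilinearAt.const_mul (c : ℝ) (hΦ : TrilinearAt Φ x) :
    TrilinearAt (fun X Y Z => c * Φ X Y Z) x where
  first Y Z hY hZ :=
    { smul := fun hf hX => by
        simp only [(hΦ.first Y Z hY hZ).smul hf hX, smul_eq_mul]
        ring
      add := fun hX hX' => by simp only [(hΦ.first Y Z hY hZ).add hX hX', mul_add] }
  second X Z hX hZ :=
    { smul := fun hf hY => by
        simp only [(hΦ.second X Z hX hZ).smul hf hY, smul_eq_mul]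
        ring
      add := fun hY hY' => by simp only [(hΦ.second X Z hX hZ).add hY hY', mul_add] }
  third X Y hX hY :=
    { smul := fun hf hZ => by
        simp only [(hΦ.third X Y hX hY).smul hf hZ, smul_eq_mul]
        ring
      add := fun hZ hZ' => by simp only [(hΦ.third X Y hX hY).add hZ hZ', mul_add] }

/-- Agreement on fields differentiable at the point is enough, because such fields are closed under
sums and under multiplication by differentiable functions. This matters for `(dω)⁺`, whose closed
formula is available only on such fields. -/
lemma TrilinearAt.congr (hΦ : TrilinearAt Φ x)
    (h : ∀ X Y Z, MDiffAt (T% X) x → MDiffAt (T% Y) x → MDiffAt (T% Z) x →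
      Ψ X Y Z = Φ X Y Z) : TrilinearAt Ψ x where
  first Y Z hY hZ :=
    { smul := fun hf hX => by
        simp only [h _ Y Z (hf.smul_section hX) hY hZ, h _ Y Z hX hY hZ,
          (hΦ.first Y Z hY hZ).smul hf hX]
      add := fun hX hX' => by
        simp only [h _ Y Z (mdifferentiableAt_add_section hX hX') hY hZ, h _ Y Z hX hY hZ,
          h _ Y Z hX' hY hZ, (hΦ.first Y Z hY hZ).add hX hX'] }
  second X Z hX hZ :=
    { smul := fun hf hY => by
        simp only [h X _ Z hX (hf.smul_section hY) hZ, h X _ Z hX hY hZ,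
          (hΦ.second X Z hX hZ).smul hf hY]
      add := fun hY hY' => by
        simp only [h X _ Z hX (mdifferentiableAt_add_section hY hY') hZ, h X _ Z hX hY hZ,
          h X _ Z hX hY' hZ, (hΦ.second X Z hX hZ).add hY hY'] }
  third X Y hX hY :=
    { smul := fun hf hZ => by
        simp only [h X Y _ hX hY (hf.smul_section hZ), h X Y _ hX hY hZ,
          (hΦ.third X Y hX hY).smul hf hZ]
      add := fun hZ hZ' => by
        simp only [h X Y _ hX hY (mdifferentiableAt_add_section hZ hZ'), h X Y _ hX hY hZ,
          h X Y _ hX hY hZ', (hΦ.third X Y hX hY).add hZ hZ'] }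

/-- Cyclic rotation carries statements about the first slot to the other two, and produces the terms
of the cyclic sum `α⁺`. -/
lemma TrilinearAt.rotate (hΦ : TrilinearAt Φ x) : TrilinearAt (fun X Y Z => Φ Y Z X) x where
  first Y Z hY hZ := hΦ.third Y Z hY hZ
  second X Z hX hZ := hΦ.first Z X hZ hX
  third X Y hX hY := hΦ.second Y X hY hX

section

variable [RiemannianBundle (fun x : M => TangentSpace I x)]

lemma IsAlmostHermitian.mdifferentiableAt_applyField (hJ : IsAlmostHermitian I J)
    {X : ∀ x : M, TangentSpace I x} (hX : MDiffAt (T% X) x) :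
    MDiffAt (T% (applyField J X)) x :=
  ((hJ.smooth.mdifferentiable (by simp)) x).clm_bundle_apply hX

lemma IsAlmostHermitian.inner_map_left (hJ : IsAlmostHermitian I J) (x : M)
    (v w : TangentSpace I x) : inner ℝ (J x v) w = -(inner ℝ v (J x w) : ℝ) := by
  rw [← hJ.inner_map x v (J x w), hJ.sq, inner_neg_right, neg_neg]

lemma TrilinearAt.comp_first (hJ : IsAlmostHermitian I J) (hΦ : TrilinearAt Φ x) :
    TrilinearAt (fun X Y Z => Φ (applyField J X) Y Z) x where
  first Y Z hY hZ :=
    { smul := fun hf hX => by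
        simp only [applyField_smul,
          (hΦ.first Y Z hY hZ).smul hf (hJ.mdifferentiableAt_applyField hX)]
      add := fun hX hX' => by
        simp only [applyField_add, (hΦ.first Y Z hY hZ).add (hJ.mdifferentiableAt_applyField hX)
          (hJ.mdifferentiableAt_applyField hX')] }
  second X Z hX hZ := hΦ.second _ Z (hJ.mdifferentiableAt_applyField hX) hZ
  third X Y hX hY := hΦ.third _ Y (hJ.mdifferentiableAt_applyField hX) hY

lemma TrilinearAt.comp_second (hJ : IsAlmostHermitian I J) (hΦ : TrilinearAt Φ x) :
    TrilinearAt (fun X Y Z => Φ X (applyField J Y) Z) x :=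
  (hΦ.rotate.rotate.comp_first hJ).rotate

lemma TrilinearAt.comp_third (hJ : IsAlmostHermitian I J) (hΦ : TrilinearAt Φ x) :
    TrilinearAt (fun X Y Z => Φ X Y (applyField J Z)) x :=
  (hΦ.rotate.comp_first hJ).rotate.rotate

lemma fundForm_swap (hJ : IsAlmostHermitian I J) (x : M) (v w : TangentSpace I x) :
    fundForm I J x v w = -fundForm I J x w v := by
  rw [fundForm, fundForm, hJ.inner_map_left, real_inner_comm]

lemma trilinearAt_inner_form
    (α : ∀ x : M, TangentSpace I x →L[ℝ] TangentSpace I x →L[ℝ] TangentSpace I x) (x : M) :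
    TrilinearAt (fun X Y Z => inner ℝ (α x (X x) (Y x)) (Z x)) x where
  first Y Z hY hZ :=
    { smul := fun hf hX => by simp [inner_smul_left]
      add := fun hX hX' => by simp [inner_add_left] }
  second X Z hX hZ :=
    { smul := fun hf hY => by simp [inner_smul_left]
      add := fun hY hY' => by simp [inner_add_left] }
  third X Y hX hY :=
    { smul := fun hf hZ => by simp [inner_smul_right]
      add := fun hZ hZ' => by simp [inner_add_right] }

lemma trilinearAt_cyclicSum
    (α : ∀ x : M, TangentSpace I x →L[ℝ] TangentSpace I x →L[ℝ] TangentSpace I x) (x : M) :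
    TrilinearAt (fun X Y Z => cyclicSum I α x (X x) (Y x) (Z x)) x :=
  ((trilinearAt_inner_form α x).add (trilinearAt_inner_form α x).rotate).add
    (trilinearAt_inner_form α x).rotate.rotate

/-- On differentiable fields `η⁺ = 3/4 η + 1/4 (η(J, J, ·) + η(J, ·, J) + η(·, J, J))`. -/
lemma plusPart_eq_of_trilinearAt (hJ : IsAlmostHermitian I J) (hΦ : TrilinearAt Φ x)
    {X Y Z : ∀ x : M, TangentSpace I x}
    (hX : MDiffAt (T% X) x) (hY : MDiffAt (T% Y) x) (hZ : MDiffAt (T% Z) x) :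
    plusPart (applyField J) Φ X Y Z = 3 / 4 * Φ X Y Z
      + 1 / 4 * Φ (applyField J X) (applyField J Y) Z
      + 1 / 4 * Φ (applyField J X) Y (applyField J Z)
      + 1 / 4 * Φ X (applyField J Y) (applyField J Z) := by
  have c (r : ℝ) {W : ∀ x : M, TangentSpace I x} (hW : MDiffAt (T% W) x) :
      MDiffAt (T% (r • W)) x :=
    (mdifferentiableAt_const (c := r)).smul_section hW
  have s₁ (r : ℝ) {X Y Z : ∀ x : M, TangentSpace I x} (hX : MDiffAt (T% X) x)
      (hY : MDiffAt (T% Y) x) (hZ : MDiffAt (T% Z) x) : Φ (r • X) Y Z = r * Φ X Y Z :=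
    (hΦ.first Y Z hY hZ).smul (f := fun _ => r) mdifferentiableAt_const hX
  have s₂ (r : ℝ) {X Y Z : ∀ x : M, TangentSpace I x} (hX : MDiffAt (T% X) x)
      (hY : MDiffAt (T% Y) x) (hZ : MDiffAt (T% Z) x) : Φ X (r • Y) Z = r * Φ X Y Z :=
    (hΦ.second X Z hX hZ).smul (f := fun _ => r) mdifferentiableAt_const hY
  have s₃ (r : ℝ) {X Y Z : ∀ x : M, TangentSpace I x} (hX : MDiffAt (T% X) x)
      (hY : MDiffAt (T% Y) x) (hZ : MDiffAt (T% Z) x) : Φ X Y (r • Z) = r * Φ X Y Z :=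
    (hΦ.third X Y hX hY).smul (f := fun _ => r) mdifferentiableAt_const hZ
  have jX := hJ.mdifferentiableAt_applyField hX
  have jY := hJ.mdifferentiableAt_applyField hY
  have jZ := hJ.mdifferentiableAt_applyField hZ
  have key (p q r p' q' r' : ℝ) :
      (complexExt Φ (p • X, p' • applyField J X) (q • Y, q' • applyField J Y)
        (r • Z, r' • applyField J Z)).re =
      p * q * r * Φ X Y Z - p * q' * r' * Φ X (applyField J Y) (applyField J Z)
        - p' * q * r' * Φ (applyField J X) Y (applyField J Z)
        - p' * q' * r * Φ (applyField J X) (applyField J Y) Z := by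
    simp only [complexExt]
    rw [s₁ p hX (c q hY) (c r hZ), s₂ q hX hY (c r hZ), s₃ r hX hY hZ,
      s₁ p hX (c q' jY) (c r' jZ), s₂ q' hX jY (c r' jZ), s₃ r' hX jY jZ,
      s₁ p' jX (c q hY) (c r' jZ), s₂ q jX hY (c r' jZ), s₃ r' jX hY jZ,
      s₁ p' jX (c q' jY) (c r hZ), s₂ q' jX jY (c r hZ), s₃ r jX jY hZ]
    ring
  -- Each of the six terms contributes 1/8 of η(X, Y, Z), hence 3/4. For a fixed pair of slots
  -- carrying J, the signs in those slots agree in two of the six terms and differ in four; with the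
  -- factor i² = -1 this leaves (4 - 2)/8 = 1/4.
  simp only [plusPart, plusVec, minusVec, Complex.add_re, key]
  ring

lemma dFundForm_swap_left (hJ : IsAlmostHermitian I J) (x : M) (X Y Z : ∀ x : M, TangentSpace I x) :
    dFundForm I J x X Y Z = -dFundForm I J x Y X Z := by
  have h : (fun y => fundForm I J y (Y y) (X y)) = -fun y => fundForm I J y (X y) (Y y) := by
    funext y
    exact fundForm_swap hJ y _ _
  rw [dFundForm, dFundForm, h, mvfderiv_neg, mlieBracket_swap_apply (V := Y) (W := X),
    fundForm_neg_left]
  simp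
  ring

lemma dFundForm_swap_right (hJ : IsAlmostHermitian I J) (x : M)
    (X Y Z : ∀ x : M, TangentSpace I x) :
    dFundForm I J x X Y Z = -dFundForm I J x X Z Y := by
  have h : (fun y => fundForm I J y (Z y) (Y y)) = -fun y => fundForm I J y (Y y) (Z y) := by
    funext y
    exact fundForm_swap hJ y _ _
  rw [dFundForm, dFundForm, h, mvfderiv_neg, mlieBracket_swap_apply (V := Z) (W := Y),
    fundForm_neg_left]
  simp
  ring

section

variable [IsContMDiffRiemannianBundle I 1 E (fun x : M => TangentSpace I x)]

lemma IsAlmostHermitian.mdifferentiableAt_fundForm (hJ : IsAlmostHermitian I J)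
    {X Y : ∀ x : M, TangentSpace I x} (hX : MDiffAt (T% X) x) (hY : MDiffAt (T% Y) x) :
    MDiffAt (fun y => fundForm I J y (X y) (Y y)) x :=
  MDifferentiableAt.inner_bundle (E := fun x : M => TangentSpace I x) (b := id)
    (hJ.mdifferentiableAt_applyField hX) hY

end

variable [IsManifold I 2 M] [CompleteSpace E]

/-- Replacing X by fX, the bracket terms containing (JY)f cancel directly, and those containing Yf
cancel because J² = -1. The second slot is similar. -/
lemma trilinearAt_inner_nijenhuis (hJ : IsAlmostHermitian I J) (x : M) :
    TrilinearAt (fun X Y Z => inner ℝ (nijenhuis I J X Y x) (Z x)) x where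
  first Y Z hY hZ :=
    { smul := fun {f X} hf hX => by
        have hN : nijenhuis I J (f • X) Y x = f x • nijenhuis I J X Y x := by
          simp only [nijenhuis, applyField_smul, mlieBracket_smul_left hf hX,
            mlieBracket_smul_left hf (hJ.mdifferentiableAt_applyField hX), map_add, map_smul]
          simp only [applyField, hJ.sq]
          module
        simp only [hN, inner_smul_left, smul_eq_mul]
        rfl
      add := fun {X X'} hX hX' => by
        simp only [← inner_add_left]
        congr 1
        simp only [nijenhuis, applyField_add, mlieBracket_add_left hX hX',
          mlieBracket_add_left (hJ.mdifferentiableAt_applyField hX)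
            (hJ.mdifferentiableAt_applyField hX'), map_add]
        module }
  second X Z hX hZ :=
    { smul := fun {f Y} hf hY => by
        have hN : nijenhuis I J X (f • Y) x = f x • nijenhuis I J X Y x := by
          simp only [nijenhuis, applyField_smul, mlieBracket_smul_right hf hY,
            mlieBracket_smul_right hf (hJ.mdifferentiableAt_applyField hY), map_add, map_smul]
          simp only [applyField, hJ.sq]
          module
        simp only [hN, inner_smul_left, smul_eq_mul]
        rfl
      add := fun {Y Y'} hY hY' => by
        simp only [← inner_add_left]
        congr 1
        simp only [nijenhuis, applyField_add, mlieBracket_add_right hY hY',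
          mlieBracket_add_right (hJ.mdifferentiableAt_applyField hY)
            (hJ.mdifferentiableAt_applyField hY'), map_add]
        module }
  third X Y hX hY :=
    { smul := fun hf hZ => by simp [inner_smul_right]
      add := fun hZ hZ' => by simp [inner_add_right] }

variable [IsContMDiffRiemannianBundle I 1 E (fun x : M => TangentSpace I x)]

/-- The derivatives of f produced by the product rule in Y(fω(X, Z)) and Z(fω(X, Y)) cancel those
produced by [fX, Y] and [fX, Z]. The remaining slots follow from antisymmetry of `dω`. -/
lemma tensorialAt_dFundForm (hJ : IsAlmostHermitian I J) {Y Z : ∀ x : M, TangentSpace I x}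
    (hY : MDiffAt (T% Y) x) (hZ : MDiffAt (T% Z) x) :
    TensorialAt I E (fun X => dFundForm I J x X Y Z) x where
  smul {f X} hf hX := by
    simp only [dFundForm, mvfderiv_fun_mul hf (hJ.mdifferentiableAt_fundForm hX hY),
      mvfderiv_fun_mul hf (hJ.mdifferentiableAt_fundForm hX hZ), mlieBracket_smul_left hf hX,
      Pi.smul_apply', fundForm_smul_left, fundForm_smul_right, fundForm_add_left, map_smul,
      add_apply, smul_apply, smul_eq_mul]
    ring
  add {X X'} hX hX' := by
    simp only [dFundForm, mvfderiv_fun_add (hJ.mdifferentiableAt_fundForm hX hY)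
        (hJ.mdifferentiableAt_fundForm hX' hY),
      mvfderiv_fun_add (hJ.mdifferentiableAt_fundForm hX hZ) (hJ.mdifferentiableAt_fundForm hX' hZ),
      mlieBracket_add_left hX hX', Pi.add_apply, fundForm_add_left, fundForm_add_right, map_add,
      add_apply]
    ring

lemma trilinearAt_dFundForm (hJ : IsAlmostHermitian I J) (x : M) :
    TrilinearAt (dFundForm I J x) x where
  first _ _ hY hZ := tensorialAt_dFundForm hJ hY hZ
  second X Z hX hZ := by
    have h (Y) : dFundForm I J x X Y Z = dFundForm I J x Y Z X := by
      rw [dFundForm_swap_left hJ, dFundForm_swap_right hJ, neg_neg]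
    simpa only [h] using tensorialAt_dFundForm hJ hZ hX
  third X Y hX hY := by
    have h (Z) : dFundForm I J x X Y Z = dFundForm I J x Z X Y := by
      rw [dFundForm_swap_right hJ, dFundForm_swap_left hJ, neg_neg]
    simpa only [h] using tensorialAt_dFundForm hJ hX hY

lemma trilinearAt_dFundFormPlus (hJ : IsAlmostHermitian I J) (x : M) :
    TrilinearAt (dFundFormPlus I J x) x := by
  have h := trilinearAt_dFundForm hJ x
  exact TrilinearAt.congr ((((h.const_mul (3 / 4)).add
    (((h.comp_first hJ).comp_second hJ).const_mul (1 / 4))).add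
    (((h.comp_first hJ).comp_third hJ).const_mul (1 / 4))).add
    (((h.comp_second hJ).comp_third hJ).const_mul (1 / 4)))
    fun _ _ _ hX hY hZ => plusPart_eq_of_trilinearAt hJ h hX hY hZ

lemma trilinearAt_torsionForm (hJ : IsAlmostHermitian I J)
    (α : ∀ x : M, TangentSpace I x →L[ℝ] TangentSpace I x →L[ℝ] TangentSpace I x) (x : M) :
    TrilinearAt (torsionForm I J α x) x := by
  have hD := trilinearAt_dFundFormPlus hJ x
  have hC := trilinearAt_cyclicSum α x
  exact TrilinearAt.congr (((((((trilinearAt_inner_nijenhuis hJ x).const_mul (-(1 / 4))).add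
    ((((hD.comp_first hJ).comp_second hJ).comp_third hJ).const_mul (-(1 / 2)))).add
    ((hD.comp_third hJ).const_mul (1 / 2))).add (hC.const_mul (1 / 2))).add
    (((hC.comp_first hJ).comp_second hJ).const_mul (-(1 / 2)))).add (trilinearAt_inner_form α x))
    fun X Y Z _ _ _ => by
      simp only [torsionForm, applyField]
      ring

end

end Tensoriality

/-! ### Linear algebra of coefficients in a standard frame. -/

section Coefficients

variable {n : ℕ}

/-- The sign in `J e_a = frameSign a • e_(a.swap)` for a standard frame `e`. -/
def frameSign : Fin n ⊕ Fin n → ℝ := Sum.elim (fun _ => 1) (fun _ => -1)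

/-- The coefficients of `dω` in a standard frame with structure constants `C`. -/
def extDerivCoeff (C : Fin n ⊕ Fin n → Fin n ⊕ Fin n → Fin n ⊕ Fin n → ℝ)
    (a b c : Fin n ⊕ Fin n) : ℝ :=
  frameSign c * C a b c.swap - frameSign b * C a c b.swap + frameSign a * C b c a.swap

/-- The coefficients of `(dω)⁺` in a standard frame with structure constants `C`. -/
def extDerivPlusCoeff (C : Fin n ⊕ Fin n → Fin n ⊕ Fin n → Fin n ⊕ Fin n → ℝ)
    (a b c : Fin n ⊕ Fin n) : ℝ :=
  3 / 4 * extDerivCoeff C a b c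
    + 1 / 4 * (frameSign a * frameSign b * extDerivCoeff C a.swap b.swap c)
    + 1 / 4 * (frameSign a * frameSign c * extDerivCoeff C a.swap b c.swap)
    + 1 / 4 * (frameSign b * frameSign c * extDerivCoeff C a b.swap c.swap)

/-- The coefficients of the Nijenhuis tensor in a standard frame with structure constants `C`. -/
def nijenhuisCoeff (C : Fin n ⊕ Fin n → Fin n ⊕ Fin n → Fin n ⊕ Fin n → ℝ)
    (a b c : Fin n ⊕ Fin n) : ℝ :=
  -(frameSign c * (frameSign a * C a.swap b c.swap + frameSign b * C a b.swap c.swap))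
    + C a b c - frameSign a * frameSign b * C a.swap b.swap c

/-- The coefficients of `α⁺`, in terms of those of `α`. -/
def cyclicCoeff (A : Fin n ⊕ Fin n → Fin n ⊕ Fin n → Fin n ⊕ Fin n → ℝ)
    (a b c : Fin n ⊕ Fin n) : ℝ :=
  A a b c + A b c a + A c a b

/-- The coefficients of `T^α` in a standard frame with structure constants `C`. -/
def torsionCoeff (C A : Fin n ⊕ Fin n → Fin n ⊕ Fin n → Fin n ⊕ Fin n → ℝ)
    (a b c : Fin n ⊕ Fin n) : ℝ :=
  -(1 / 4) * nijenhuisCoeff C a b c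
    - 1 / 2 * (frameSign a * frameSign b * frameSign c *
        extDerivPlusCoeff C a.swap b.swap c.swap)
    + 1 / 2 * (frameSign c * extDerivPlusCoeff C a b c.swap)
    + 1 / 2 * cyclicCoeff A a b c
    - 1 / 2 * (frameSign a * frameSign b * cyclicCoeff A a.swap b.swap c)
    + A a b c

/-- The coefficients of `α^t` in a standard frame with structure constants `C`. -/
def gauduchonCoeff (t : ℝ) (C : Fin n ⊕ Fin n → Fin n ⊕ Fin n → Fin n ⊕ Fin n → ℝ)
    (a b c : Fin n ⊕ Fin n) : ℝ :=
  t / 4 * (frameSign a * frameSign b * frameSign c * extDerivPlusCoeff C a.swap b.swap c.swap)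
    + t / 4 * (frameSign c * extDerivPlusCoeff C a b c.swap)

/-- The coefficients of the metric connection with torsion coefficients `T` in an orthonormal
frame with structure constants `C`: `g(∇_{e_a} e_b, e_c)`. -/
def connectionCoeff (C T : Fin n ⊕ Fin n → Fin n ⊕ Fin n → Fin n ⊕ Fin n → ℝ)
    (a b c : Fin n ⊕ Fin n) : ℝ :=
  1 / 2 * ((C a b c + T a b c) - (C b c a + T b c a) + (C c a b + T c a b))

variable {C A T : Fin n ⊕ Fin n → Fin n ⊕ Fin n → Fin n ⊕ Fin n → ℝ}

@[simp] lemma frameSign_inl (i : Fin n) : frameSign (inl i) = 1 := rfl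

@[simp] lemma frameSign_inr (i : Fin n) : frameSign (inr i) = -1 := rfl

lemma extDerivPlusCoeff_swap (hC : ∀ a b c, C b a c = -C a b c) (a b c : Fin n ⊕ Fin n) :
    extDerivPlusCoeff C b a c = -extDerivPlusCoeff C a b c := by
  have h (a b c : Fin n ⊕ Fin n) : extDerivCoeff C b a c = -extDerivCoeff C a b c := by
    simp only [extDerivCoeff, hC a b]
    ring
  simp only [extDerivPlusCoeff, h a b, h a.swap b.swap, h a.swap b, h a b.swap]
  ring

lemma torsionCoeff_swap (hC : ∀ a b c, C b a c = -C a b c) (hA : ∀ a b c, A b a c = -A a b c)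
    (a b c : Fin n ⊕ Fin n) : torsionCoeff C A b a c = -torsionCoeff C A a b c := by
  have h (a b c : Fin n ⊕ Fin n) : cyclicCoeff A b a c = -cyclicCoeff A a b c := by
    simp only [cyclicCoeff, hA a b, hA c a, hA b c]
    ring
  simp only [torsionCoeff, nijenhuisCoeff, extDerivPlusCoeff_swap hC a b,
    extDerivPlusCoeff_swap hC a.swap b.swap, h a b, h a.swap b.swap, hC a b, hC a.swap b.swap,
    hC a b.swap, hC a.swap b, hA a b]
  ring

lemma gauduchonCoeff_swap (t : ℝ) (hC : ∀ a b c, C b a c = -C a b c) (a b c : Fin n ⊕ Fin n) :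
    gauduchonCoeff t C b a c = -gauduchonCoeff t C a b c := by
  simp only [gauduchonCoeff, extDerivPlusCoeff_swap hC a b,
    extDerivPlusCoeff_swap hC a.swap b.swap]
  ring

/-- Replacing (X, Y) by (JX, JY) exchanges the two terms defining `α^t`, since the two signs from J²
cancel. -/
lemma gauduchonCoeff_type11 (t : ℝ) (a b c : Fin n ⊕ Fin n) :
    frameSign a * frameSign b * gauduchonCoeff t C a.swap b.swap c = gauduchonCoeff t C a b c := by
  rcases a with i | i <;> rcases b with j | j <;> rcases c with k | k <;>
  · simp only [gauduchonCoeff, extDerivPlusCoeff, extDerivCoeff, Sum.swap_inl, Sum.swap_inr,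
      frameSign_inl, frameSign_inr]
    ring

/-- With S = C + T, antisymmetric in its first two indices, the torsion equation reads Γ_abc - Γ_bac
= S_abc and metricity reads Γ_acb = -Γ_abc. The Koszul combination of S satisfies both, whatever the
antisymmetric T. -/
lemma connectionCoeff_swap_right (hC : ∀ a b c, C b a c = -C a b c)
    (hT : ∀ a b c, T b a c = -T a b c) (a b c : Fin n ⊕ Fin n) :
    connectionCoeff C T a c b = -connectionCoeff C T a b c := by
  simp only [connectionCoeff, hC b a, hC c b, hC a c, hT b a, hT c b, hT a c]
  ring

lemma connectionCoeff_sub_swap (hC : ∀ a b c, C b a c = -C a b c)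
    (hT : ∀ a b c, T b a c = -T a b c) (a b c : Fin n ⊕ Fin n) :
    connectionCoeff C T a b c - connectionCoeff C T b a c = C a b c + T a b c := by
  simp only [connectionCoeff, hC b a, hC c b, hC a c, hT b a, hT c b, hT a c]
  ring

/-- This is `∇J = 0` on the frame: since J is skew, the second summand is -g(J∇_{e_a} e_b, e_c),
while the first is g(∇_{e_a}(J e_b), e_c). -/
lemma connectionCoeff_complex (hC : ∀ a b c, C b a c = -C a b c)
    (hA : ∀ a b c, A b a c = -A a b c)
    (hA' : ∀ a b c, frameSign a * frameSign b * A a.swap b.swap c = A a b c)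
    (a b c : Fin n ⊕ Fin n) :
    frameSign b * connectionCoeff C (torsionCoeff C A) a b.swap c
      + frameSign c * connectionCoeff C (torsionCoeff C A) a b c.swap = 0 := by
  -- Type (1,1) leaves only the blocks (inl, inl) and (inl, inr) of A. Together with a fixed order
  -- for each antisymmetric pair this is a normal form in which the identity becomes a cancellation
  -- of monomials.
  have h₁ (i j c) : A (inr i) (inr j) c = A (inl i) (inl j) c := by
    simpa using (hA' (inl i) (inl j) c)
  have h₂ (i j c) : A (inr i) (inl j) c = -A (inl i) (inr j) c := by
    have := hA' (inl i) (inr j) c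
    simp at this
    linarith
  rcases a with i | i <;> rcases b with j | j <;> rcases c with k | k <;>
  · simp only [connectionCoeff, torsionCoeff, nijenhuisCoeff, cyclicCoeff, extDerivPlusCoeff,
      extDerivCoeff, Sum.swap_inl, Sum.swap_inr, frameSign_inl, frameSign_inr, h₁, h₂,
      hC (inl _) (inr _), hC (inl i) (inl j), hC (inl i) (inl k), hC (inl j) (inl k),
      hC (inr i) (inr j), hC (inr i) (inr k), hC (inr j) (inr k),
      hA (inl i) (inl k)]
    ring

/-- The torsion components of `∇^α` in a standard frame. -/
lemma hermitianTorsionFormulas_torsionCoeff (hC : ∀ a b c, C b a c = -C a b c)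
    (hA : ∀ a b c, A b a c = -A a b c)
    (hA' : ∀ a b c, frameSign a * frameSign b * A a.swap b.swap c = A a b c) :
    HermitianTorsionFormulas C A (torsionCoeff C A) := by
  have h₁ (i j c) : A (inr i) (inr j) c = A (inl i) (inl j) c := by
    simpa using (hA' (inl i) (inl j) c)
  have h₂ (i j c) : A (inr i) (inl j) c = -A (inl i) (inr j) c := by
    have := hA' (inl i) (inr j) c
    simp at this
    linarith
  -- Type (1,1) and antisymmetry make the mixed block symmetric in i and j. It is applied only to
  -- the pairs (k, i) and (k, j), moving k to the second place.
  have h₃ (i j c) : A (inl i) (inr j) c = A (inl j) (inr i) c := by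
    rw [← neg_neg (A (inl i) (inr j) c), ← h₂, hA, neg_neg]
  constructor <;> intro i j k <;>
  · simp only [torsionCoeff, nijenhuisCoeff, cyclicCoeff, extDerivPlusCoeff,
      extDerivCoeff, Sum.swap_inl, Sum.swap_inr, frameSign_inl, frameSign_inr, h₁, h₂,
      hC (inl _) (inr _), hC (inl i) (inl k), hC (inl j) (inl k),
      hC (inr i) (inr k), hC (inr j) (inr k),
      hA (inl i) (inl k), hA (inl j) (inl k), h₃ k i, h₃ k j]
    ring

/-- The torsion components of the Gauduchon connection with parameter `t` in a standard frame. -/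
lemma gauduchonTorsionFormulas_torsionCoeff (t : ℝ) (hC : ∀ a b c, C b a c = -C a b c) :
    GauduchonTorsionFormulas t C (torsionCoeff C (gauduchonCoeff t C)) := by
  -- With `α^t` expanded, both sides are linear in C alone, so antisymmetry of C suffices.
  constructor <;> intro i j k <;>
  · simp only [torsionCoeff, nijenhuisCoeff, cyclicCoeff, gauduchonCoeff, extDerivPlusCoeff,
      extDerivCoeff, Sum.swap_inl, Sum.swap_inr, frameSign_inl, frameSign_inr,
      hC (inl _) (inr _), hC (inl i) (inl j), hC (inl i) (inl k), hC (inl j) (inl k),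
      hC (inr i) (inr j), hC (inr i) (inr k), hC (inr j) (inr k)]
    ring

end Coefficients

/-! ### Evaluation of tensors on the left-invariant frame. -/

section Frame

variable {E : Type*} [NormedAddCommGroup E] [NormedSpace ℝ E] [FiniteDimensional ℝ E]
  {G : Type*} [TopologicalSpace G] [ChartedSpace E G] [Group G] [LieGroup 𝓘(ℝ, E) ∞ G]
  [RiemannianBundle (fun x : G => TangentSpace 𝓘(ℝ, E) x)]
  {J : ∀ x : G, TangentSpace 𝓘(ℝ, E) x →L[ℝ] TangentSpace 𝓘(ℝ, E) x}
  {n : ℕ} {e : Module.Basis (Fin n ⊕ Fin n) ℝ (GroupLieAlgebra 𝓘(ℝ, E) G)}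

/-- The left-invariant vector fields of a standard frame, as an orthonormal basis of each tangent
space. -/
def IsStandardFrame.orthonormalBasis (he : IsStandardFrame 𝓘(ℝ, E) J e) (x : G) :
    OrthonormalBasis (Fin n ⊕ Fin n) ℝ (TangentSpace 𝓘(ℝ, E) x) :=
  OrthonormalBasis.mk (he.orthonormal x) <| by
    have h : Fintype.card (Fin n ⊕ Fin n) = Module.finrank ℝ (TangentSpace 𝓘(ℝ, E) x) :=
      (Module.finrank_eq_card_basis e).symm
    have : FiniteDimensional ℝ (TangentSpace 𝓘(ℝ, E) x) :=
      inferInstanceAs (FiniteDimensional ℝ E)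
    exact ((he.orthonormal x).linearIndependent.span_eq_top_of_card_eq_finrank' h).ge

@[simp] lemma IsStandardFrame.orthonormalBasis_apply (he : IsStandardFrame 𝓘(ℝ, E) J e) (x : G)
    (a : Fin n ⊕ Fin n) : he.orthonormalBasis x a = mulInvariantVectorField (e a) x := by
  simp [IsStandardFrame.orthonormalBasis]

lemma IsStandardFrame.sum_inner_smul (he : IsStandardFrame 𝓘(ℝ, E) J e) (x : G)
    (v : TangentSpace 𝓘(ℝ, E) x) :
    ∑ a, (inner ℝ (mulInvariantVectorField (e a) x) v : ℝ) • mulInvariantVectorField (e a) x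
      = v := by
  simpa using (he.orthonormalBasis x).sum_repr' v

lemma IsStandardFrame.inner_frame (he : IsStandardFrame 𝓘(ℝ, E) J e) (x : G)
    (a b : Fin n ⊕ Fin n) :
    inner ℝ (mulInvariantVectorField (e a) x) (mulInvariantVectorField (e b) x) =
      if a = b then (1 : ℝ) else 0 :=
  orthonormal_iff_ite.1 (he.orthonormal x) a b

lemma IsStandardFrame.ext_inner (he : IsStandardFrame 𝓘(ℝ, E) J e) {x : G}
    {v w : TangentSpace 𝓘(ℝ, E) x}
    (h : ∀ a, inner ℝ v (mulInvariantVectorField (e a) x) =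
      (inner ℝ w (mulInvariantVectorField (e a) x) : ℝ)) : v = w := by
  rw [← he.sum_inner_smul x v, ← he.sum_inner_smul x w]
  refine Finset.sum_congr rfl fun a _ => ?_
  rw [real_inner_comm, h, real_inner_comm]

lemma IsStandardFrame.applyField_frame (he : IsStandardFrame 𝓘(ℝ, E) J e)
    (hJ : IsAlmostHermitian 𝓘(ℝ, E) J) (a : Fin n ⊕ Fin n) :
    applyField J (mulInvariantVectorField (e a)) =
      frameSign a • mulInvariantVectorField (e a.swap) := by
  funext x
  rcases a with i | i
  · simp [applyField, he.map_J]
  · simp [applyField, ← he.map_J, hJ.sq]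

lemma IsStandardFrame.map_frame (he : IsStandardFrame 𝓘(ℝ, E) J e)
    (hJ : IsAlmostHermitian 𝓘(ℝ, E) J) (a : Fin n ⊕ Fin n) (x : G) :
    J x (mulInvariantVectorField (e a) x) =
      frameSign a • mulInvariantVectorField (e a.swap) x :=
  congrFun (he.applyField_frame hJ a) x

lemma mdifferentiableAt_leftInvariant (v : GroupLieAlgebra 𝓘(ℝ, E) G) (x : G) :
    MDiffAt (T% (mulInvariantVectorField v)) x := by
  have : LieGroup 𝓘(ℝ, E) (minSmoothness ℝ 3) G := by
    simp only [minSmoothness_of_isRCLikeNormedField]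
    infer_instance
  exact mdifferentiableAt_mulInvariantVectorField v

/-- The map `v ↦ X_v(x)`, where `X_v` is the left-invariant field with value `v` at `1`. -/
def leftInvariantEval (x : G) : GroupLieAlgebra 𝓘(ℝ, E) G →ₗ[ℝ] TangentSpace 𝓘(ℝ, E) x where
  toFun v := mulInvariantVectorField v x
  map_add' v w := congrFun (mulInvariantVectorField_add v w) x
  map_smul' c v := congrFun (mulInvariantVectorField_smul c v) x

lemma mulInvariantVectorField_sum_smul {ι : Type*} (s : Finset ι) (r : ι → ℝ)
    (v : ι → GroupLieAlgebra 𝓘(ℝ, E) G) (x : G) :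
    mulInvariantVectorField (∑ i ∈ s, r i • v i) x =
      ∑ i ∈ s, r i • (mulInvariantVectorField (v i) x : TangentSpace 𝓘(ℝ, E) x) := by
  change leftInvariantEval x (∑ i ∈ s, r i • v i) = ∑ i ∈ s, r i • leftInvariantEval x (v i)
  simp only [map_sum, map_smul]

lemma mlieBracket_frame (a b : Fin n ⊕ Fin n) (x : G) :
    mlieBracket 𝓘(ℝ, E) (mulInvariantVectorField (e a)) (mulInvariantVectorField (e b)) x =
      ∑ c, structConst 𝓘(ℝ, E) e a b c • mulInvariantVectorField (e c) x := by
  have : LieGroup 𝓘(ℝ, E) (minSmoothness ℝ 3) G := by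
    simp only [minSmoothness_of_isRCLikeNormedField]
    infer_instance
  have : CompleteSpace E := FiniteDimensional.complete ℝ E
  rw [← mulInvariantVector_mlieBracket, ← GroupLieAlgebra.bracket_def]
  rw [← mulInvariantVectorField_sum_smul]
  simp only [structConst, e.sum_repr]

lemma structConst_swap (a b c : Fin n ⊕ Fin n) :
    structConst 𝓘(ℝ, E) e b a c = -structConst 𝓘(ℝ, E) e a b c := by
  simp only [structConst, GroupLieAlgebra.bracket_def]
  rw [mlieBracket_swap_apply, map_neg, Finsupp.neg_apply]

lemma mulInvariantVectorField_one (v : GroupLieAlgebra 𝓘(ℝ, E) G) :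
    mulInvariantVectorField v 1 = v := by
  have h : HasMFDerivAt 𝓘(ℝ, E) 𝓘(ℝ, E) (fun y : G => 1 * y) 1
      (ContinuousLinearMap.id ℝ (TangentSpace 𝓘(ℝ, E) (1 : G))) :=
    (hasMFDerivAt_id (1 : G)).congr_of_eventuallyEq (.of_forall one_mul)
  exact DFunLike.congr_fun h.mfderiv v

lemma IsStandardFrame.inner_mlieBracket (he : IsStandardFrame 𝓘(ℝ, E) J e) (x : G)
    (a b c : Fin n ⊕ Fin n) :
    inner ℝ (mlieBracket 𝓘(ℝ, E) (mulInvariantVectorField (e a))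
      (mulInvariantVectorField (e b)) x) (mulInvariantVectorField (e c) x) =
      structConst 𝓘(ℝ, E) e a b c := by
  rw [mlieBracket_frame]
  simp [-Fintype.sum_sum_type, sum_inner, inner_smul_left, he.inner_frame]

/-- A tensorial operation sees only the value of X at x, so X may be replaced by the combination of
frame fields with coefficients frozen at x; these constants then factor out. -/
lemma IsStandardFrame.tensorial_eq_sum (he : IsStandardFrame 𝓘(ℝ, E) J e)
    {F : Type*} [AddCommGroup F] [Module ℝ F]
    {x : G} {Φ : (∀ x : G, TangentSpace 𝓘(ℝ, E) x) → F}
    (hΦ : TensorialAt 𝓘(ℝ, E) E Φ x) {X : ∀ x : G, TangentSpace 𝓘(ℝ, E) x}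
    (hX : MDiffAt (T% X) x) :
    Φ X = ∑ a, (inner ℝ (mulInvariantVectorField (e a) x) (X x) : ℝ) •
      Φ (mulInvariantVectorField (e a)) := by
  have hd (a) : MDiffAt (T% ((fun _ : G => (inner ℝ (mulInvariantVectorField (e a) x) (X x) : ℝ)) •
      mulInvariantVectorField (e a))) x :=
    mdifferentiableAt_const.smul_section (mdifferentiableAt_leftInvariant (e a) x)
  rw [hΦ.pointwise hX (MDifferentiableAt.sum_section fun a _ => hd a)
    (he.sum_inner_smul x (X x)).symm, hΦ.sum _ fun a _ => hd a]
  exact Finset.sum_congr rfl fun a _ => hΦ.smul (f := fun _ => _) mdifferentiableAt_const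
    (mdifferentiableAt_leftInvariant (e a) x)

lemma IsStandardFrame.trilinear_congr (he : IsStandardFrame 𝓘(ℝ, E) J e) {x : G}
    {Φ Ψ : (∀ x : G, TangentSpace 𝓘(ℝ, E) x) → (∀ x : G, TangentSpace 𝓘(ℝ, E) x) →
      (∀ x : G, TangentSpace 𝓘(ℝ, E) x) → ℝ} (hΦ : TrilinearAt Φ x) (hΨ : TrilinearAt Ψ x)
    (h : ∀ a b c, Φ (mulInvariantVectorField (e a)) (mulInvariantVectorField (e b))
        (mulInvariantVectorField (e c)) =
      Ψ (mulInvariantVectorField (e a)) (mulInvariantVectorField (e b))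
        (mulInvariantVectorField (e c)))
    {X Y Z : ∀ x : G, TangentSpace 𝓘(ℝ, E) x}
    (hX : MDiffAt (T% X) x) (hY : MDiffAt (T% Y) x) (hZ : MDiffAt (T% Z) x) :
    Φ X Y Z = Ψ X Y Z := by
  have d (a) := mdifferentiableAt_leftInvariant (e a) x
  rw [he.tensorial_eq_sum (hΦ.first Y Z hY hZ) hX, he.tensorial_eq_sum (hΨ.first Y Z hY hZ) hX]
  refine Finset.sum_congr rfl fun a _ => congrArg _ ?_
  rw [he.tensorial_eq_sum (hΦ.second _ Z (d a) hZ) hY,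
    he.tensorial_eq_sum (hΨ.second _ Z (d a) hZ) hY]
  refine Finset.sum_congr rfl fun b _ => congrArg _ ?_
  rw [he.tensorial_eq_sum (hΦ.third _ _ (d a) (d b)) hZ,
    he.tensorial_eq_sum (hΨ.third _ _ (d a) (d b)) hZ]
  exact Finset.sum_congr rfl fun c _ => congrArg _ (h a b c)

variable [IsContMDiffRiemannianBundle 𝓘(ℝ, E) ∞ E (fun x : G => TangentSpace 𝓘(ℝ, E) x)]

lemma mvfderiv_inner_leftInvariant (hleft : IsLeftInvariantStructure 𝓘(ℝ, E) J)
    (v w : GroupLieAlgebra 𝓘(ℝ, E) G) (x : G) :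
    mvfderiv 𝓘(ℝ, E) (fun y => (inner ℝ (mulInvariantVectorField v y)
      (mulInvariantVectorField w y) : ℝ)) x = 0 := by
  simp only [fun y => hleft.metric v w y 1]
  exact mvfderiv_const _

lemma IsStandardFrame.fundForm_right (he : IsStandardFrame 𝓘(ℝ, E) J e)
    (hJ : IsAlmostHermitian 𝓘(ℝ, E) J) (x : G) (v : TangentSpace 𝓘(ℝ, E) x)
    (c : Fin n ⊕ Fin n) :
    fundForm 𝓘(ℝ, E) J x v (mulInvariantVectorField (e c) x) =
      -(frameSign c * inner ℝ v (mulInvariantVectorField (e c.swap) x)) := by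
  rw [fundForm, hJ.inner_map_left, he.map_frame hJ, inner_smul_right]

/-- The three derivative terms vanish because `ω` is constant on left-invariant fields. The brackets
contribute structure constants, with signs from moving J across the inner product. -/
lemma IsStandardFrame.dFundForm_frame (he : IsStandardFrame 𝓘(ℝ, E) J e)
    (hJ : IsAlmostHermitian 𝓘(ℝ, E) J) (hleft : IsLeftInvariantStructure 𝓘(ℝ, E) J) (x : G)
    (a b c : Fin n ⊕ Fin n) :
    dFundForm 𝓘(ℝ, E) J x (mulInvariantVectorField (e a)) (mulInvariantVectorField (e b))
      (mulInvariantVectorField (e c)) = extDerivCoeff (structConst 𝓘(ℝ, E) e) a b c := by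
  have h (v w : GroupLieAlgebra 𝓘(ℝ, E) G) : mvfderiv 𝓘(ℝ, E) (fun y =>
      fundForm 𝓘(ℝ, E) J y (mulInvariantVectorField v y) (mulInvariantVectorField w y)) x = 0 := by
    simp only [fundForm, hleft.complex]
    exact mvfderiv_inner_leftInvariant hleft _ _ x
  simp only [dFundForm, h]
  simp only [he.fundForm_right hJ, he.inner_mlieBracket, extDerivCoeff]
  simp
  ring

lemma trilinear_smul {x : G}
    {Φ : (∀ x : G, TangentSpace 𝓘(ℝ, E) x) → (∀ x : G, TangentSpace 𝓘(ℝ, E) x) →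
      (∀ x : G, TangentSpace 𝓘(ℝ, E) x) → ℝ} (hΦ : TrilinearAt Φ x) (r s t : ℝ)
    (u v w : GroupLieAlgebra 𝓘(ℝ, E) G) :
    Φ (r • mulInvariantVectorField u) (s • mulInvariantVectorField v)
      (t • mulInvariantVectorField w) =
      r * s * t * Φ (mulInvariantVectorField u) (mulInvariantVectorField v)
        (mulInvariantVectorField w) := by
  have d (v : GroupLieAlgebra 𝓘(ℝ, E) G) := mdifferentiableAt_leftInvariant v x
  have d' (r : ℝ) (v : GroupLieAlgebra 𝓘(ℝ, E) G) :
      MDiffAt (T% (r • mulInvariantVectorField v)) x :=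
    (mdifferentiableAt_const (c := r)).smul_section (d v)
  have h₁ := (hΦ.first _ _ (d' s v) (d' t w)).smul (f := fun _ => r) mdifferentiableAt_const (d u)
  have h₂ := (hΦ.second _ _ (d u) (d' t w)).smul (f := fun _ => s) mdifferentiableAt_const (d v)
  have h₃ := (hΦ.third _ _ (d u) (d v)).smul (f := fun _ => t) mdifferentiableAt_const (d w)
  rw [mul_assoc, mul_assoc]
  exact h₁.trans (congrArg (r * ·) (h₂.trans (congrArg (s * ·) h₃)))

lemma IsStandardFrame.dFundFormPlus_frame (he : IsStandardFrame 𝓘(ℝ, E) J e)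
    (hJ : IsAlmostHermitian 𝓘(ℝ, E) J) (hleft : IsLeftInvariantStructure 𝓘(ℝ, E) J) (x : G)
    (a b c : Fin n ⊕ Fin n) :
    dFundFormPlus 𝓘(ℝ, E) J x (mulInvariantVectorField (e a)) (mulInvariantVectorField (e b))
      (mulInvariantVectorField (e c)) = extDerivPlusCoeff (structConst 𝓘(ℝ, E) e) a b c := by
  have hD := trilinearAt_dFundForm hJ x
  have d (v : GroupLieAlgebra 𝓘(ℝ, E) G) := mdifferentiableAt_leftInvariant v x
  have s := trilinear_smul hD
  -- These are the cases where J acts on exactly two of the three arguments, as in the closed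
  -- formula for `η⁺`.
  have s₁ := fun p q => s p q 1
  have s₂ := fun p q => s p 1 q
  have s₃ := fun p q => s 1 p q
  simp only [one_smul, mul_one, one_mul] at s₁ s₂ s₃
  rw [dFundFormPlus, plusPart_eq_of_trilinearAt hJ hD (d _) (d _) (d _)]
  simp only [he.applyField_frame hJ, s₁, s₂, s₃, he.dFundForm_frame hJ hleft, extDerivPlusCoeff]

lemma IsStandardFrame.inner_nijenhuis_frame (he : IsStandardFrame 𝓘(ℝ, E) J e)
    (hJ : IsAlmostHermitian 𝓘(ℝ, E) J) (x : G) (a b c : Fin n ⊕ Fin n) :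
    inner ℝ (nijenhuis 𝓘(ℝ, E) J (mulInvariantVectorField (e a)) (mulInvariantVectorField (e b)) x)
      (mulInvariantVectorField (e c) x) = nijenhuisCoeff (structConst 𝓘(ℝ, E) e) a b c := by
  have d (v : GroupLieAlgebra 𝓘(ℝ, E) G) := mdifferentiableAt_leftInvariant v x
  have d' (r : ℝ) (v : GroupLieAlgebra 𝓘(ℝ, E) G) :
      MDiffAt (T% (r • mulInvariantVectorField v)) x :=
    (mdifferentiableAt_const (c := r)).smul_section (d v)
  simp only [nijenhuis, he.applyField_frame hJ, mlieBracket_const_smul_left (d _),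
    mlieBracket_const_smul_right (d _), inner_add_left, inner_sub_left,
    hJ.inner_map_left, he.map_frame hJ, inner_smul_left, inner_smul_right, he.inner_mlieBracket,
    nijenhuisCoeff]
  simp
  ring

lemma cyclicSum_frame
    (α : ∀ x : G, TangentSpace 𝓘(ℝ, E) x →L[ℝ] TangentSpace 𝓘(ℝ, E) x →L[ℝ]
      TangentSpace 𝓘(ℝ, E) x) (x : G) (a b c : Fin n ⊕ Fin n) :
    cyclicSum 𝓘(ℝ, E) α x (mulInvariantVectorField (e a) x) (mulInvariantVectorField (e b) x)
      (mulInvariantVectorField (e c) x) = cyclicCoeff (component 𝓘(ℝ, E) e α x) a b c := rfl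

lemma IsStandardFrame.torsionForm_frame (he : IsStandardFrame 𝓘(ℝ, E) J e)
    (hJ : IsAlmostHermitian 𝓘(ℝ, E) J) (hleft : IsLeftInvariantStructure 𝓘(ℝ, E) J)
    (α : ∀ x : G, TangentSpace 𝓘(ℝ, E) x →L[ℝ] TangentSpace 𝓘(ℝ, E) x →L[ℝ]
      TangentSpace 𝓘(ℝ, E) x) (x : G) (a b c : Fin n ⊕ Fin n) :
    torsionForm 𝓘(ℝ, E) J α x (mulInvariantVectorField (e a)) (mulInvariantVectorField (e b))
      (mulInvariantVectorField (e c)) =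
      torsionCoeff (structConst 𝓘(ℝ, E) e) (component 𝓘(ℝ, E) e α x) a b c := by
  have s := trilinear_smul (trilinearAt_dFundFormPlus hJ x)
  have s₃ := s 1 1
  simp only [one_smul, mul_one] at s₃
  have hc (r s : ℝ) (u v w : TangentSpace 𝓘(ℝ, E) x) :
      cyclicSum 𝓘(ℝ, E) α x (r • u) (s • v) w = r * s * cyclicSum 𝓘(ℝ, E) α x u v w := by
    simp [cyclicSum, inner_smul_left, inner_smul_right]
    ring
  simp only [torsionForm, he.inner_nijenhuis_frame hJ, he.applyField_frame hJ, s, s₃,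
    he.dFundFormPlus_frame hJ hleft, he.map_frame hJ, hc, cyclicSum_frame, torsionCoeff, one_mul]
  rfl

lemma IsStandardFrame.gauduchon_frame (he : IsStandardFrame 𝓘(ℝ, E) J e)
    (hJ : IsAlmostHermitian 𝓘(ℝ, E) J) (hleft : IsLeftInvariantStructure 𝓘(ℝ, E) J)
    (t : ℝ) (x : G) (a b c : Fin n ⊕ Fin n) :
    t / 4 * dFundFormPlus 𝓘(ℝ, E) J x (applyField J (mulInvariantVectorField (e a)))
        (applyField J (mulInvariantVectorField (e b))) (applyField J (mulInvariantVectorField (e c)))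
      + t / 4 * dFundFormPlus 𝓘(ℝ, E) J x (mulInvariantVectorField (e a))
        (mulInvariantVectorField (e b)) (applyField J (mulInvariantVectorField (e c))) =
      gauduchonCoeff t (structConst 𝓘(ℝ, E) e) a b c := by
  have s := trilinear_smul (trilinearAt_dFundFormPlus hJ x)
  have s₃ := s 1 1
  simp only [one_smul, mul_one] at s₃
  simp only [he.applyField_frame hJ, s, s₃, he.dFundFormPlus_frame hJ hleft, gauduchonCoeff,
    one_mul]

end Frame

/-! ### Left-invariant tensor fields from constant coefficients; the Gauduchon form. -/

section Tensors

variable {E : Type*} [NormedAddCommGroup E] [NormedSpace ℝ E] [FiniteDimensional ℝ E]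
  {G : Type*} [TopologicalSpace G] [ChartedSpace E G] [Group G] [LieGroup 𝓘(ℝ, E) ∞ G]
  [RiemannianBundle (fun x : G => TangentSpace 𝓘(ℝ, E) x)]
  {J : ∀ x : G, TangentSpace 𝓘(ℝ, E) x →L[ℝ] TangentSpace 𝓘(ℝ, E) x}
  {n : ℕ} {e : Module.Basis (Fin n ⊕ Fin n) ℝ (GroupLieAlgebra 𝓘(ℝ, E) G)}

lemma IsStandardFrame.ext_bilinear (he : IsStandardFrame 𝓘(ℝ, E) J e) {x : G}
    {β γ : TangentSpace 𝓘(ℝ, E) x →L[ℝ] TangentSpace 𝓘(ℝ, E) x →L[ℝ] TangentSpace 𝓘(ℝ, E) x}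
    (h : ∀ a b c, inner ℝ (β (mulInvariantVectorField (e a) x) (mulInvariantVectorField (e b) x))
        (mulInvariantVectorField (e c) x) =
      (inner ℝ (γ (mulInvariantVectorField (e a) x) (mulInvariantVectorField (e b) x))
        (mulInvariantVectorField (e c) x) : ℝ)) : β = γ := by
  refine ContinuousLinearMap.coe_injective ((he.orthonormalBasis x).toBasis.ext fun a => ?_)
  refine ContinuousLinearMap.coe_injective ((he.orthonormalBasis x).toBasis.ext fun b => ?_)
  simpa using he.ext_inner (h a b)

/-- The `TG`-valued bilinear tensor field with coefficients `A` in the frame `e`. -/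
def tensorOfCoeff (e : Module.Basis (Fin n ⊕ Fin n) ℝ (GroupLieAlgebra 𝓘(ℝ, E) G))
    (A : Fin n ⊕ Fin n → Fin n ⊕ Fin n → Fin n ⊕ Fin n → ℝ) (x : G) :
    TangentSpace 𝓘(ℝ, E) x →L[ℝ] TangentSpace 𝓘(ℝ, E) x →L[ℝ] TangentSpace 𝓘(ℝ, E) x :=
  ∑ a, ∑ b, ∑ c, A a b c • (innerSL ℝ (mulInvariantVectorField (e a) x)).smulRight
    ((innerSL ℝ (mulInvariantVectorField (e b) x)).smulRight (mulInvariantVectorField (e c) x))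

lemma tensorOfCoeff_apply (A : Fin n ⊕ Fin n → Fin n ⊕ Fin n → Fin n ⊕ Fin n → ℝ) (x : G)
    (u v : TangentSpace 𝓘(ℝ, E) x) :
    tensorOfCoeff e A x u v = ∑ a, ∑ b, ∑ c,
      (A a b c * ((inner ℝ (mulInvariantVectorField (e a) x) u : ℝ) *
        (inner ℝ (mulInvariantVectorField (e b) x) v : ℝ))) • mulInvariantVectorField (e c) x := by
  simp [-Fintype.sum_sum_type, tensorOfCoeff, mul_smul]

lemma IsStandardFrame.inner_tensorOfCoeff (he : IsStandardFrame 𝓘(ℝ, E) J e)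
    (A : Fin n ⊕ Fin n → Fin n ⊕ Fin n → Fin n ⊕ Fin n → ℝ) (x : G) (a b c : Fin n ⊕ Fin n) :
    inner ℝ (tensorOfCoeff e A x (mulInvariantVectorField (e a) x)
      (mulInvariantVectorField (e b) x)) (mulInvariantVectorField (e c) x) = A a b c := by
  simp [-Fintype.sum_sum_type, tensorOfCoeff_apply, he.inner_frame, sum_inner, inner_smul_left]

lemma tensorOfCoeff_leftInvariant (hleft : IsLeftInvariantStructure 𝓘(ℝ, E) J)
    (A : Fin n ⊕ Fin n → Fin n ⊕ Fin n → Fin n ⊕ Fin n → ℝ)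
    (v w : GroupLieAlgebra 𝓘(ℝ, E) G) : ∃ u : GroupLieAlgebra 𝓘(ℝ, E) G, ∀ x : G,
    tensorOfCoeff e A x (mulInvariantVectorField v x) (mulInvariantVectorField w x) =
      mulInvariantVectorField u x := by
  -- The coefficients may be read off at 1, since inner products of left-invariant fields are
  -- constant.
  refine ⟨∑ c, (∑ a, ∑ b, A a b c *
    ((inner ℝ (mulInvariantVectorField (e a) 1) (mulInvariantVectorField v 1) : ℝ) *
      (inner ℝ (mulInvariantVectorField (e b) 1) (mulInvariantVectorField w 1) : ℝ))) • e c,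
    fun x => ?_⟩
  rw [mulInvariantVectorField_sum_smul, tensorOfCoeff_apply]
  simp only [fun a v => hleft.metric (e a) v x 1, Finset.sum_smul]
  rw [Finset.sum_comm_cycle]

lemma component_eq_component_one (hleft : IsLeftInvariantStructure 𝓘(ℝ, E) J)
    {α : ∀ x : G, TangentSpace 𝓘(ℝ, E) x →L[ℝ] TangentSpace 𝓘(ℝ, E) x →L[ℝ]
      TangentSpace 𝓘(ℝ, E) x} (hα : IsLeftInvariantForm11 𝓘(ℝ, E) J α) (x : G) :
    component 𝓘(ℝ, E) e α x = component 𝓘(ℝ, E) e α 1 := by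
  funext a b c
  simp only [component, hα.leftInvariant]
  exact hleft.metric _ _ _ _

lemma component_swap
    {α : ∀ x : G, TangentSpace 𝓘(ℝ, E) x →L[ℝ] TangentSpace 𝓘(ℝ, E) x →L[ℝ]
      TangentSpace 𝓘(ℝ, E) x} (hα : IsLeftInvariantForm11 𝓘(ℝ, E) J α) (x : G)
    (a b c : Fin n ⊕ Fin n) : component 𝓘(ℝ, E) e α x b a c = -component 𝓘(ℝ, E) e α x a b c := by
  have h (u v : TangentSpace 𝓘(ℝ, E) x) : α x v u = -α x u v := by
    have := hα.alternating x (u + v)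
    simp only [map_add, add_apply, hα.alternating, zero_add, add_zero] at this
    exact eq_neg_of_add_eq_zero_left this
  rw [component, h, inner_neg_left, component]

lemma IsStandardFrame.component_type11 (he : IsStandardFrame 𝓘(ℝ, E) J e)
    (hJ : IsAlmostHermitian 𝓘(ℝ, E) J)
    {α : ∀ x : G, TangentSpace 𝓘(ℝ, E) x →L[ℝ] TangentSpace 𝓘(ℝ, E) x →L[ℝ]
      TangentSpace 𝓘(ℝ, E) x} (hα : IsLeftInvariantForm11 𝓘(ℝ, E) J α) (x : G)
    (a b c : Fin n ⊕ Fin n) :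
    frameSign a * frameSign b * component 𝓘(ℝ, E) e α x a.swap b.swap c =
      component 𝓘(ℝ, E) e α x a b c := by
  have h := hα.type11 x (mulInvariantVectorField (e a) x) (mulInvariantVectorField (e b) x)
  rw [component, component, ← h]
  simp [he.map_frame hJ, inner_smul_left]
  ring

lemma IsStandardFrame.isLeftInvariantForm11_tensorOfCoeff (he : IsStandardFrame 𝓘(ℝ, E) J e)
    (hJ : IsAlmostHermitian 𝓘(ℝ, E) J) (hleft : IsLeftInvariantStructure 𝓘(ℝ, E) J)
    {A : Fin n ⊕ Fin n → Fin n ⊕ Fin n → Fin n ⊕ Fin n → ℝ} (hA : ∀ a b c, A b a c = -A a b c)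
    (hA' : ∀ a b c, frameSign a * frameSign b * A a.swap b.swap c = A a b c) :
    IsLeftInvariantForm11 𝓘(ℝ, E) J (tensorOfCoeff e A) where
  alternating x v := by
    have h : tensorOfCoeff e A x v v = -tensorOfCoeff e A x v v := by
      conv_lhs => rw [tensorOfCoeff_apply, Finset.sum_comm]
      rw [tensorOfCoeff_apply]
      simp only [← Finset.sum_neg_distrib, ← neg_smul]
      refine Finset.sum_congr rfl fun a _ => Finset.sum_congr rfl fun b _ =>
        Finset.sum_congr rfl fun c _ => ?_
      rw [hA a b]
      congr 1
      ring
    have h₂ : (2 : ℝ) • tensorOfCoeff e A x v v = 0 := by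
      rw [two_smul]
      exact eq_neg_iff_add_eq_zero.1 h
    exact (smul_eq_zero_iff_right two_ne_zero).1 h₂
  type11 x v w := by
    -- Precomposition reaches only the first slot; the flips bring the second slot there, so that
    -- `jA.flip` is (u, v) ↦ α(Ju, Jv).
    let jA := ((tensorOfCoeff e A x).comp (J x)).flip.comp (J x)
    have h : jA.flip = tensorOfCoeff e A x := he.ext_bilinear fun a b c => by
      simp [jA, he.map_frame hJ, inner_smul_left, he.inner_tensorOfCoeff, ← hA' a b c]
      ring
    exact congrArg (fun β => β v w) h
  leftInvariant v w x := by
    obtain ⟨u, hu⟩ := tensorOfCoeff_leftInvariant (e := e) hleft A v w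
    have h := hu 1
    simp only [mulInvariantVectorField_one] at h
    rw [hu, h]

variable [IsContMDiffRiemannianBundle 𝓘(ℝ, E) ∞ E (fun x : G => TangentSpace 𝓘(ℝ, E) x)]

/-- Testing on the frame forces the coefficients. Conversely, both sides of the defining equation
are trilinear, so agreement on the frame suffices. -/
lemma IsStandardFrame.isGauduchonForm_iff (he : IsStandardFrame 𝓘(ℝ, E) J e)
    (hJ : IsAlmostHermitian 𝓘(ℝ, E) J) (hleft : IsLeftInvariantStructure 𝓘(ℝ, E) J) (t : ℝ)
    (α : ∀ x : G, TangentSpace 𝓘(ℝ, E) x →L[ℝ] TangentSpace 𝓘(ℝ, E) x →L[ℝ]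
      TangentSpace 𝓘(ℝ, E) x) :
    IsGauduchonForm 𝓘(ℝ, E) J t α ↔
      α = tensorOfCoeff e (gauduchonCoeff t (structConst 𝓘(ℝ, E) e)) := by
  have d (v : GroupLieAlgebra 𝓘(ℝ, E) G) (x : G) := mdifferentiableAt_leftInvariant v x
  constructor
  · intro h
    funext x
    refine he.ext_bilinear fun a b c => ?_
    rw [h x _ _ _ (d _ x) (d _ x) (d _ x), he.gauduchon_frame hJ hleft, he.inner_tensorOfCoeff]
  · rintro rfl x X Y Z hX hY hZ
    have hD := trilinearAt_dFundFormPlus hJ x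
    refine he.trilinear_congr (trilinearAt_inner_form _ x)
      (((((hD.comp_first hJ).comp_second hJ).comp_third hJ).const_mul (t / 4)).add
        ((hD.comp_third hJ).const_mul (t / 4))) (fun a b c => ?_) hX hY hZ
    rw [he.inner_tensorOfCoeff, he.gauduchon_frame hJ hleft]

end Tensors

/-! ### Construction of the Hermitian connection and its torsion. -/

section Connection

variable {E : Type*} [NormedAddCommGroup E] [NormedSpace ℝ E] [FiniteDimensional ℝ E]
  [CompleteSpace E]
  {G : Type*} [TopologicalSpace G] [ChartedSpace E G] [Group G] [LieGroup 𝓘(ℝ, E) ∞ G]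
  [RiemannianBundle (fun x : G => TangentSpace 𝓘(ℝ, E) x)]
  [IsContMDiffRiemannianBundle 𝓘(ℝ, E) ∞ E (fun x : G => TangentSpace 𝓘(ℝ, E) x)]
  {J : ∀ x : G, TangentSpace 𝓘(ℝ, E) x →L[ℝ] TangentSpace 𝓘(ℝ, E) x}
  {n : ℕ} {e : Module.Basis (Fin n ⊕ Fin n) ℝ (GroupLieAlgebra 𝓘(ℝ, E) G)}

lemma mdifferentiableAt_inner_frame (v : GroupLieAlgebra 𝓘(ℝ, E) G) {x : G}
    {Y : ∀ x : G, TangentSpace 𝓘(ℝ, E) x} (hY : MDiffAt (T% Y) x) :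
    MDiffAt (fun y => (inner ℝ (mulInvariantVectorField v y) (Y y) : ℝ)) x :=
  MDifferentiableAt.inner_bundle (E := fun x : G => TangentSpace 𝓘(ℝ, E) x) (b := id)
    (mdifferentiableAt_leftInvariant v x) hY

/-- The connection for which the left-invariant vector fields of the standard frame `e` are
parallel. -/
def IsStandardFrame.flatConnection (he : IsStandardFrame 𝓘(ℝ, E) J e) :
    CovariantDerivative 𝓘(ℝ, E) E (fun x : G => TangentSpace 𝓘(ℝ, E) x) where
  toFun Y x := ∑ a, (mvfderiv 𝓘(ℝ, E) (fun y => (inner ℝ (mulInvariantVectorField (e a) y)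
    (Y y) : ℝ)) x).smulRight (mulInvariantVectorField (e a) x)
  isCovariantDerivativeOnUniv :=
    { add := fun {Y Y' x} hY hY' _ => by
        rw [← Finset.sum_add_distrib]
        refine Finset.sum_congr rfl fun a _ => ?_
        simp only [Pi.add_apply, inner_add_right]
        rw [mvfderiv_fun_add (mdifferentiableAt_inner_frame (e a) hY)
          (mdifferentiableAt_inner_frame (e a) hY')]
        ext v
        simp [add_smul]
      leibniz := fun {Y f x} hY hf _ => by
        ext v
        simp only [Pi.smul_apply', inner_smul_right]
        simp only [fun a => mvfderiv_fun_mul hf (mdifferentiableAt_inner_frame (e a) hY)]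
        -- Expanding Y(x) in the frame splits the term df ⊗ Y into components matching the left-hand
        -- sum.
        conv_rhs => rw [add_apply, ContinuousLinearMap.smulRight_apply, ← he.sum_inner_smul x (Y x)]
        simp only [add_apply, smul_apply, sum_apply, ContinuousLinearMap.smulRight_apply,
          Finset.smul_sum]
        rw [← Finset.sum_add_distrib]
        refine Finset.sum_congr rfl fun a _ => ?_
        simp only [smul_eq_mul]
        module }

/-- The connection with coefficients `g(∇_{e_a} e_b, e_c) = Γ a b c` in the standard frame `e`. -/
def IsStandardFrame.connection (he : IsStandardFrame 𝓘(ℝ, E) J e)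
    (Γ : Fin n ⊕ Fin n → Fin n ⊕ Fin n → Fin n ⊕ Fin n → ℝ) :
    CovariantDerivative 𝓘(ℝ, E) E (fun x : G => TangentSpace 𝓘(ℝ, E) x) :=
  -- The added form takes the differentiated vector first and the direction second, whereas Γ lists
  -- the direction first; hence the flip.
  he.flatConnection.addOneForm fun x => (tensorOfCoeff e Γ x).flip

variable {Γ : Fin n ⊕ Fin n → Fin n ⊕ Fin n → Fin n ⊕ Fin n → ℝ}

lemma IsStandardFrame.connection_leftInvariant (he : IsStandardFrame 𝓘(ℝ, E) J e)
    (hleft : IsLeftInvariantStructure 𝓘(ℝ, E) J) (w : GroupLieAlgebra 𝓘(ℝ, E) G) (x : G)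
    (u : TangentSpace 𝓘(ℝ, E) x) :
    he.connection Γ (mulInvariantVectorField w) x u =
      tensorOfCoeff e Γ x u (mulInvariantVectorField w x) := by
  have h : he.flatConnection (mulInvariantVectorField w) x = 0 := by
    simp only [IsStandardFrame.flatConnection, mvfderiv_inner_leftInvariant hleft]
    simp
  have h' : he.connection Γ (mulInvariantVectorField w) x =
      he.flatConnection (mulInvariantVectorField w) x +
        (tensorOfCoeff e Γ x).flip (mulInvariantVectorField w x) := rfl
  rw [h', h, zero_add, ContinuousLinearMap.flip_apply]

lemma IsStandardFrame.isLeftInvariantConnection_connection (he : IsStandardFrame 𝓘(ℝ, E) J e)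
    (hleft : IsLeftInvariantStructure 𝓘(ℝ, E) J) :
    IsLeftInvariantConnection 𝓘(ℝ, E) (he.connection Γ) := by
  intro v w
  obtain ⟨u, hu⟩ := tensorOfCoeff_leftInvariant (e := e) hleft Γ v w
  exact ⟨u, fun x => by rw [he.connection_leftInvariant hleft, hu]⟩

/-- On the frame the derivative of g(e_b, e_c) is zero, so `∇g` reduces to -(Γ_abc + Γ_acb). -/
lemma IsStandardFrame.isMetricCompatible_connection (he : IsStandardFrame 𝓘(ℝ, E) J e)
    (hleft : IsLeftInvariantStructure 𝓘(ℝ, E) J) (hΓ : ∀ a b c, Γ a c b = -Γ a b c) :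
    CovariantDerivative.IsMetricCompatible (V := fun x : G => TangentSpace 𝓘(ℝ, E) x)
      (he.connection Γ) := by
  rw [CovariantDerivative.IsMetricCompatible]
  funext x
  have d (a) := mdifferentiableAt_leftInvariant (e a) x
  refine ContinuousLinearMap.coe_injective ((he.orthonormalBasis x).toBasis.ext fun b => ?_)
  refine ContinuousLinearMap.coe_injective ((he.orthonormalBasis x).toBasis.ext fun c => ?_)
  refine ContinuousLinearMap.coe_injective ((he.orthonormalBasis x).toBasis.ext fun a => ?_)
  have h := CovariantDerivative.derivMetricTensor_apply
    (V := fun x : G => TangentSpace 𝓘(ℝ, E) x) (he.connection Γ)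
    (X := mulInvariantVectorField (e a)) x (d b) (d c)
  simp only [he.connection_leftInvariant hleft, mvfderiv_inner_leftInvariant hleft,
    he.inner_tensorOfCoeff] at h
  rw [real_inner_comm, he.inner_tensorOfCoeff, hΓ a b c] at h
  simpa using h

/-- The difference ∇(JY) - J∇Y is tensorial in Y: both terms produce the same df ⊗ JY. Its vanishing
is therefore tested on the frame. -/
lemma IsStandardFrame.connection_applyField (he : IsStandardFrame 𝓘(ℝ, E) J e)
    (hJ : IsAlmostHermitian 𝓘(ℝ, E) J) (hleft : IsLeftInvariantStructure 𝓘(ℝ, E) J)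
    (hΓ : ∀ a b c, frameSign b * Γ a b.swap c + frameSign c * Γ a b c.swap = 0)
    (x : G) (Y : ∀ x : G, TangentSpace 𝓘(ℝ, E) x) (hY : MDiffAt (T% Y) x)
    (v : TangentSpace 𝓘(ℝ, E) x) :
    he.connection Γ (applyField J Y) x v = J x (he.connection Γ Y x v) := by
  have hcov := (he.connection Γ).isCovariantDerivativeOnUniv
  have hΦ : TensorialAt 𝓘(ℝ, E) E (fun Y => he.connection Γ (applyField J Y) x v -
      J x (he.connection Γ Y x v)) x :=
    { smul := fun {f Y} hf hY => by
        simp only [applyField_smul, hcov.leibniz hY hf,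
          hcov.leibniz (hJ.mdifferentiableAt_applyField hY) hf]
        simp [applyField]
        module
      add := fun {Y Y'} hY hY' => by
        simp only [applyField_add, hcov.add hY hY',
          hcov.add (hJ.mdifferentiableAt_applyField hY) (hJ.mdifferentiableAt_applyField hY')]
        simp
        module }
  have hb (b) : he.connection Γ (applyField J (mulInvariantVectorField (e b))) x v -
      J x (he.connection Γ (mulInvariantVectorField (e b)) x v) = 0 := by
    have hL : frameSign b • (tensorOfCoeff e Γ x).flip (mulInvariantVectorField (e b.swap) x) =
        (J x).comp ((tensorOfCoeff e Γ x).flip (mulInvariantVectorField (e b) x)) := by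
      refine ContinuousLinearMap.coe_injective ((he.orthonormalBasis x).toBasis.ext fun a => ?_)
      refine he.ext_inner fun c => ?_
      have := hΓ a b c
      simp [hJ.inner_map_left, he.map_frame hJ, inner_smul_left, inner_smul_right,
        he.inner_tensorOfCoeff]
      linarith
    rw [he.applyField_frame hJ, hcov.smul_const _ (mdifferentiableAt_leftInvariant _ x),
      smul_apply, he.connection_leftInvariant hleft, he.connection_leftInvariant hleft]
    exact sub_eq_zero.2 (congrArg (fun L => L v) hL)
  have h := he.tensorial_eq_sum hΦ hY
  simp only [hb, smul_zero, Finset.sum_const_zero] at h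
  exact sub_eq_zero.1 h

lemma IsStandardFrame.hasTorsionOf_iff (he : IsStandardFrame 𝓘(ℝ, E) J e)
    (hJ : IsAlmostHermitian 𝓘(ℝ, E) J) (hleft : IsLeftInvariantStructure 𝓘(ℝ, E) J)
    (α : ∀ x : G, TangentSpace 𝓘(ℝ, E) x →L[ℝ] TangentSpace 𝓘(ℝ, E) x →L[ℝ]
      TangentSpace 𝓘(ℝ, E) x)
    (cov : CovariantDerivative 𝓘(ℝ, E) E (fun x : G => TangentSpace 𝓘(ℝ, E) x)) :
    HasTorsionOf 𝓘(ℝ, E) J α cov ↔ ∀ x, component 𝓘(ℝ, E) e cov.torsion x =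
      torsionCoeff (structConst 𝓘(ℝ, E) e) (component 𝓘(ℝ, E) e α x) := by
  have d (v : GroupLieAlgebra 𝓘(ℝ, E) G) (x : G) := mdifferentiableAt_leftInvariant v x
  constructor
  · intro h x
    funext a b c
    rw [← he.torsionForm_frame hJ hleft, ← h x _ _ _ (d _ x) (d _ x) (d _ x), component]
  · intro h x X Y Z hX hY hZ
    refine he.trilinear_congr (trilinearAt_inner_form cov.torsion x)
      (trilinearAt_torsionForm hJ α x) (fun a b c => ?_) hX hY hZ
    rw [he.torsionForm_frame hJ hleft, ← h x, component]

lemma IsStandardFrame.torsion_connection (he : IsStandardFrame 𝓘(ℝ, E) J e)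
    (hleft : IsLeftInvariantStructure 𝓘(ℝ, E) J) (x : G) (a b c : Fin n ⊕ Fin n) :
    component 𝓘(ℝ, E) e (he.connection Γ).torsion x a b c =
      Γ a b c - Γ b a c - structConst 𝓘(ℝ, E) e a b c := by
  have d (v : GroupLieAlgebra 𝓘(ℝ, E) G) := mdifferentiableAt_leftInvariant v x
  rw [component, CovariantDerivative.torsion_apply _ (d _) (d _),
    he.connection_leftInvariant hleft, he.connection_leftInvariant hleft, inner_sub_left,
    inner_sub_left, he.inner_tensorOfCoeff, he.inner_tensorOfCoeff, he.inner_mlieBracket]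

/-- Existence of the left-invariant Hermitian connection with torsion `T^α`. -/
lemma IsStandardFrame.exists_hermitianConnection (he : IsStandardFrame 𝓘(ℝ, E) J e)
    (hJ : IsAlmostHermitian 𝓘(ℝ, E) J) (hleft : IsLeftInvariantStructure 𝓘(ℝ, E) J)
    {α : ∀ x : G, TangentSpace 𝓘(ℝ, E) x →L[ℝ] TangentSpace 𝓘(ℝ, E) x →L[ℝ]
      TangentSpace 𝓘(ℝ, E) x} (hα : IsLeftInvariantForm11 𝓘(ℝ, E) J α) :
    ∃ cov : CovariantDerivative 𝓘(ℝ, E) E (fun x : G => TangentSpace 𝓘(ℝ, E) x),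
      IsLeftInvariantConnection 𝓘(ℝ, E) cov ∧ IsHermitianConnection 𝓘(ℝ, E) J cov ∧
        HasTorsionOf 𝓘(ℝ, E) J α cov := by
  have hC := structConst_swap (e := e)
  have hA := component_swap (e := e) hα 1
  have hT := torsionCoeff_swap hC hA
  -- Constant coefficients are needed, so those of `α` are taken at the identity; left-invariance
  -- makes them the same at every point.
  refine ⟨he.connection (connectionCoeff (structConst 𝓘(ℝ, E) e)
    (torsionCoeff (structConst 𝓘(ℝ, E) e) (component 𝓘(ℝ, E) e α 1))),
    he.isLeftInvariantConnection_connection hleft,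
    ⟨he.isMetricCompatible_connection hleft (connectionCoeff_swap_right hC hT),
      he.connection_applyField hJ hleft
        (connectionCoeff_complex hC hA (he.component_type11 hJ hα 1))⟩,
    (he.hasTorsionOf_iff hJ hleft _ _).2 fun x => ?_⟩
  funext a b c
  rw [he.torsion_connection hleft, connectionCoeff_sub_swap hC hT,
    component_eq_component_one hleft hα x]
  ring

end Connection

end AlmostHermitian

end

/-! ### The main theorem. -/

open AlmostHermitian in
theorem mainTheorem5 {E : Type*} [NormedAddCommGroup E] [NormedSpace ℝ E]
    [FiniteDimensional ℝ E] [CompleteSpace E]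
    {G : Type*} [TopologicalSpace G] [ChartedSpace E G] [Group G] [LieGroup 𝓘(ℝ, E) ∞ G]
    [RiemannianBundle (fun x : G => TangentSpace 𝓘(ℝ, E) x)]
    [IsContMDiffRiemannianBundle 𝓘(ℝ, E) ∞ E (fun x : G => TangentSpace 𝓘(ℝ, E) x)]
    (J : ∀ x : G, TangentSpace 𝓘(ℝ, E) x →L[ℝ] TangentSpace 𝓘(ℝ, E) x)
    (hJ : IsAlmostHermitian 𝓘(ℝ, E) J) (hleft : IsLeftInvariantStructure 𝓘(ℝ, E) J)
    {n : ℕ} (e : Module.Basis (Fin n ⊕ Fin n) ℝ (GroupLieAlgebra 𝓘(ℝ, E) G))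
    (he : IsStandardFrame 𝓘(ℝ, E) J e) :
    (∀ α : ∀ x : G, TangentSpace 𝓘(ℝ, E) x →L[ℝ] TangentSpace 𝓘(ℝ, E) x →L[ℝ]
        TangentSpace 𝓘(ℝ, E) x,
      IsLeftInvariantForm11 𝓘(ℝ, E) J α →
      (∃ cov : CovariantDerivative 𝓘(ℝ, E) E (fun x : G => TangentSpace 𝓘(ℝ, E) x),
        IsLeftInvariantConnection 𝓘(ℝ, E) cov ∧ IsHermitianConnection 𝓘(ℝ, E) J cov ∧
          HasTorsionOf 𝓘(ℝ, E) J α cov) ∧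
      ∀ cov : CovariantDerivative 𝓘(ℝ, E) E (fun x : G => TangentSpace 𝓘(ℝ, E) x),
        IsLeftInvariantConnection 𝓘(ℝ, E) cov → IsHermitianConnection 𝓘(ℝ, E) J cov →
        HasTorsionOf 𝓘(ℝ, E) J α cov →
        ∀ x : G, HermitianTorsionFormulas (structConst 𝓘(ℝ, E) e)
          (component 𝓘(ℝ, E) e α 1) (component 𝓘(ℝ, E) e cov.torsion x)) ∧
    (∀ t : ℝ,
      ∃! α : ∀ x : G, TangentSpace 𝓘(ℝ, E) x →L[ℝ] TangentSpace 𝓘(ℝ, E) x →L[ℝ]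
          TangentSpace 𝓘(ℝ, E) x,
        IsGauduchonForm 𝓘(ℝ, E) J t α) ∧
    (∀ (t : ℝ) (α : ∀ x : G, TangentSpace 𝓘(ℝ, E) x →L[ℝ] TangentSpace 𝓘(ℝ, E) x →L[ℝ]
        TangentSpace 𝓘(ℝ, E) x),
      IsGauduchonForm 𝓘(ℝ, E) J t α →
      IsLeftInvariantForm11 𝓘(ℝ, E) J α ∧
      ∀ cov : CovariantDerivative 𝓘(ℝ, E) E (fun x : G => TangentSpace 𝓘(ℝ, E) x),
        IsLeftInvariantConnection 𝓘(ℝ, E) cov → IsHermitianConnection 𝓘(ℝ, E) J cov →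
        HasTorsionOf 𝓘(ℝ, E) J α cov →
        ∀ x : G, GauduchonTorsionFormulas t (structConst 𝓘(ℝ, E) e)
          (component 𝓘(ℝ, E) e cov.torsion x)) := by
  refine ⟨fun α hα => ⟨he.exists_hermitianConnection hJ hleft hα, fun cov _ _ hcov x => ?_⟩,
    fun t => ?_, fun t α hα => ?_⟩
  · rw [(he.hasTorsionOf_iff hJ hleft α cov).1 hcov x, component_eq_component_one hleft hα x]
    exact hermitianTorsionFormulas_torsionCoeff structConst_swap (component_swap hα 1)
      (he.component_type11 hJ hα 1)
  · exact ⟨_, (he.isGauduchonForm_iff hJ hleft t _).2 rfl,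
      fun α hα => (he.isGauduchonForm_iff hJ hleft t α).1 hα⟩
  -- From here `α` is the explicit tensor, whose coefficients are the same at every point.
  · obtain rfl := (he.isGauduchonForm_iff hJ hleft t α).1 hα
    refine ⟨he.isLeftInvariantForm11_tensorOfCoeff hJ hleft
      (gauduchonCoeff_swap t structConst_swap) (gauduchonCoeff_type11 t), fun cov _ _ hcov x => ?_⟩
    have h : component 𝓘(ℝ, E) e (tensorOfCoeff e (gauduchonCoeff t (structConst 𝓘(ℝ, E) e))) x =
        gauduchonCoeff t (structConst 𝓘(ℝ, E) e) := by
      funext a b c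
      exact he.inner_tensorOfCoeff _ x a b c
    rw [(he.hasTorsionOf_iff hJ hleft _ cov).1 hcov x, h]
    exact gauduchonTorsionFormulas_torsionCoeff t structConst_swap
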